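/- Let $f:[1,\infty)\to[1,\infty)$ be a function with the following properties: $f(1)=1$ and $f(x)<x$ for $x>1$; $f$ is strictly increasing to $\infty$; $\lim_{x\to\infty} f(x)/x^q=0$ for all $q>0$; $x\mapsto x/f(x)$ is concave on $[1,\infty)$; and $f(x)f(y)\ge f(xy)$ for $x,y\ge 1$. The function $f(x)=\log_2(x+1)$ has these properties. Let $c_{00}$ be the space of finitely supported real sequences. For $x=(x_n)\in c_{00}$ and a finite $E\subset\mathbb N$ let $E(x)$ be the sequence that agrees with $x$ on $E$ and vanishes off $E$; for finite sets $E,F\subset\mathbb N$ write $E<F$ if every element of $E$ is smaller than every element of $F$. Put $|x|_0=\max_n|x_n|$ and $$|x|_{k+1}=\sup\Big\{\frac1{f(\ell)}\sum_{i=1}^{\ell}|E_i(x)|_k:\ \ell\ge 1,\ E_1<E_2<\dots<E_\ell\Big\}\quad(k\ge 0),\qquad \|x\|=\sup_{k\ge 0}|x|_k .$$ Let $X$ be the completion of $(c_{00},\|\cdot\|)$, and extend $x\mapsto E(x)$ continuously to $X$. For $\ell\ge 1$ and $x\in X$ put $$\|x\|_\ell=\sup_{E_1<\dots<E_\ell}\frac1{f(\ell)}\sum_{i=1}^{\ell}\|E_i(x)\|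 .$$ If $\lambda>1$, an equivalent norm $|\cdot|$ on an infinite-dimensional Banach space $(B,\|\cdot\|)$ is called a $\lambda$-distortion of $B$ if $\sup\{|y_1|/|y_2| : y_1,y_2\in Y,\ \|y_1\|=\|y_2\|=1\}\ge\lambda$ for every infinite-dimensional linear subspace $Y$ of $B$; and $B$ is called arbitrarily distortable if it has a $\lambda$-distortion for every $\lambda>1$. Theorem 3. For every $\ell\ge 1$, every $\varepsilon>0$ and every infinite-dimensional linear subspace $Z$ of $X$ there are $z_1,z_2\in Z$ with $\|z_1\|=\|z_2\|=1$, $$\|z_1\|_\ell\ge 1-\varepsilon\qquad\text{and}\qquad \|z_2\|_\ell\le\frac{1+\varepsilon}{f(\ell)} .$$ In particular, $\|\cdot\|_\ell$ is an $f(\ell)$-distortion of $X$ for every $\ell\ge 2$, and $X$ is arbitrarily distortable. -/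

import Mathlib

noncomputable section

/-! ### Distortions of Banach spaces -/

/-- `N` is a `lam`-distortion of the infinite dimensional Banach space `E`: `lam > 1`, `N` is an
equivalent norm on `E`, and on every infinite dimensional linear subspace `Y` the supremum of
`N y₁ / N y₂` over the unit vectors `y₁, y₂` of `Y` is at least `lam`. Since `N` is equivalent to
the given norm, the set of these ratios is bounded and `sSup` is its supremum. -/
structure IsDistortion {E : Type*} [NormedAddCommGroup E] [NormedSpace ℝ E] [CompleteSpace E]
    (lam : ℝ) (N : E → ℝ) : Prop where
  infinite_dimensional : ¬ FiniteDimensional ℝ E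
  one_lt : 1 < lam
  add_le : ∀ x y : E, N (x + y) ≤ N x + N y
  smul_eq : ∀ (a : ℝ) (x : E), N (a • x) = |a| * N x
  equivalent : ∃ c C : ℝ, 0 < c ∧ 0 < C ∧ ∀ x : E, c * ‖x‖ ≤ N x ∧ N x ≤ C * ‖x‖
  le_sup : ∀ Y : Submodule ℝ E, ¬ FiniteDimensional ℝ Y →
    lam ≤ sSup {r : ℝ | ∃ y₁ ∈ Y, ∃ y₂ ∈ Y, ‖y₁‖ = 1 ∧ ‖y₂‖ = 1 ∧ r = N y₁ / N y₂}

/-- `E` is arbitrarily distortable: it has a `lam`-distortion for every `lam > 1`. -/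
def ArbitrarilyDistortable (E : Type*) [NormedAddCommGroup E] [NormedSpace ℝ E]
    [CompleteSpace E] : Prop :=
  ∀ lam : ℝ, 1 < lam → ∃ N : E → ℝ, IsDistortion lam N

/-! ### The space `X` -/

/-- The properties `(f₁)`, ..., `(f₅)` of a function `f : [1, ∞) → [1, ∞)`; only the values of `f`
on `[1, ∞)` matter. That `f ≥ 1` on `[1, ∞)` follows from `f 1 = 1` and monotonicity. -/
structure IsAdmissible (f : ℝ → ℝ) : Prop where
  map_one : f 1 = 1
  lt_self : ∀ x : ℝ, 1 < x → f x < x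
  strictMonoOn : StrictMonoOn f (Set.Ici 1)
  tendsto_atTop : Filter.Tendsto f Filter.atTop Filter.atTop
  tendsto_div_rpow : ∀ q : ℝ, 0 < q →
    Filter.Tendsto (fun x : ℝ => f x / x ^ q) Filter.atTop (nhds 0)
  concaveOn : ConcaveOn ℝ (Set.Ici 1) (fun x : ℝ => x / f x)
  le_mul : ∀ x y : ℝ, 1 ≤ x → 1 ≤ y → f (x * y) ≤ f x * f y

/-- `E₁ < E₂ < ⋯ < E_ℓ` for finite sets of natural numbers. Empty sets may occur; as they contribute
`0` to the sums below, and far away singletons can replace them, this does not change a supremum. -/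
def Successive {l : ℕ} (E : Fin l → Finset ℕ) : Prop :=
  ∀ i j : Fin l, i < j → ∀ a ∈ E i, ∀ b ∈ E j, a < b

/-- `E(x) = ∑_{i ∈ E} x_i e_i` for a finitely supported sequence `x`. -/
def restr (E : Finset ℕ) (x : ℕ →₀ ℝ) : ℕ →₀ ℝ := x.filter (fun n => n ∈ E)

/-- The norms `|x|_k` on `c₀₀`: `|x|_0 = max_n |x_n|`, and `|x|_{k+1}` is the supremum of
`(1 / f ℓ) ∑_{i ≤ ℓ} |E_i(x)|_k` over all `ℓ ≥ 1` and all `E₁ < ⋯ < E_ℓ`. -/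
def iterNorm (f : ℝ → ℝ) : ℕ → (ℕ →₀ ℝ) → ℝ
  | 0, x => ⨆ n, |x n|
  | k + 1, x => sSup {r : ℝ | ∃ l : ℕ, 1 ≤ l ∧ ∃ E : Fin l → Finset ℕ, Successive E ∧
      r = 1 / f l * ∑ i, iterNorm f k (restr (E i) x)}

/-- `‖x‖ = sup_k |x|_k` on `c₀₀`. -/
def limNorm (f : ℝ → ℝ) (x : ℕ →₀ ℝ) : ℝ := ⨆ k, iterNorm f k x

section Aux

/-- The `ℓ₁`-norm on `c₀₀`, used as an upper bound. -/
def oneNorm (x : ℕ →₀ ℝ) : ℝ := ∑ n ∈ x.support, |x n|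

theorem restr_apply (E : Finset ℕ) (x : ℕ →₀ ℝ) (n : ℕ) :
    restr E x n = if n ∈ E then x n else 0 := Finsupp.filter_apply _ _ _

theorem restr_add (E : Finset ℕ) (x y : ℕ →₀ ℝ) : restr E (x + y) = restr E x + restr E y := by
  ext n; simp only [restr_apply, Finsupp.add_apply]; split_ifs <;> simp

theorem restr_smul (E : Finset ℕ) (a : ℝ) (x : ℕ →₀ ℝ) : restr E (a • x) = a • restr E x := by
  ext n; simp only [restr_apply, Finsupp.smul_apply]; split_ifs <;> simp

theorem restr_restr (E F : Finset ℕ) (x : ℕ →₀ ℝ) :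
    restr E (restr F x) = restr (E ∩ F) x := by
  ext n; simp only [restr_apply, Finset.mem_inter]; split_ifs <;> simp_all

theorem oneNorm_eq_of_subset (x : ℕ →₀ ℝ) (s : Finset ℕ) (h : x.support ⊆ s) :
    oneNorm x = ∑ n ∈ s, |x n| := by
  refine Finset.sum_subset h fun n _ hn => ?_
  simp [Finsupp.notMem_support_iff.1 hn]

theorem abs_le_oneNorm (x : ℕ →₀ ℝ) (n : ℕ) : |x n| ≤ oneNorm x := by
  rw [oneNorm_eq_of_subset x (insert n x.support) (Finset.subset_insert _ _)]
  exact Finset.single_le_sum (f := fun m => |x m|) (fun _ _ => abs_nonneg _)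
    (Finset.mem_insert_self _ _)

theorem sum_oneNorm_le {l : ℕ} (E : Fin l → Finset ℕ) (hE : Successive E) (x : ℕ →₀ ℝ) :
    ∑ i, oneNorm (restr (E i) x) ≤ oneNorm x := by
  have h1 : ∀ i, oneNorm (restr (E i) x) = ∑ n ∈ x.support, |restr (E i) x n| := fun i => by
    refine oneNorm_eq_of_subset _ _ fun n hn => ?_
    rw [Finsupp.mem_support_iff, restr_apply] at hn
    rw [Finsupp.mem_support_iff]
    intro h; simp [h] at hn
  simp only [h1]
  rw [Finset.sum_comm]
  refine Finset.sum_le_sum fun n _ => ?_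
  by_cases h : ∃ i, n ∈ E i
  · obtain ⟨i, hi⟩ := h
    rw [Finset.sum_eq_single i]
    · simp [restr_apply, hi]
    · intro j _ hj
      have : n ∉ E j := fun hn => by
        rcases lt_or_gt_of_ne hj with h | h
        · exact lt_irrefl _ (hE j i h n hn n hi)
        · exact lt_irrefl _ (hE i j h n hi n hn)
      simp [restr_apply, this]
    · simp
  · push Not at h
    simp [restr_apply, h]

/-- The properties of `|·|_k` which pass from `k` to `k + 1` and to the limit. -/
structure IsGood (N : (ℕ →₀ ℝ) → ℝ) : Prop where
  nonneg : ∀ x, 0 ≤ N x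
  le_one : ∀ x, N x ≤ oneNorm x
  add_le : ∀ x y, N (x + y) ≤ N x + N y
  smul_eq : ∀ (a : ℝ) x, N (a • x) = |a| * N x
  restr_le : ∀ E x, N (restr E x) ≤ N x

theorem smul_eq_of_le {N : (ℕ →₀ ℝ) → ℝ} (h0 : ∀ x, 0 ≤ N x)
    (h : ∀ (a : ℝ) x, N (a • x) ≤ |a| * N x) (a : ℝ) (x : ℕ →₀ ℝ) : N (a • x) = |a| * N x := by
  refine le_antisymm (h a x) ?_
  rcases eq_or_ne a 0 with rfl | ha
  · simpa using h0 _
  · have := h a⁻¹ (a • x)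
    rw [inv_smul_smul₀ ha, abs_inv] at this
    have ha' : 0 < |a| := abs_pos.2 ha
    calc |a| * N x ≤ |a| * (|a|⁻¹ * N (a • x)) := by gcongr
      _ = N (a • x) := by field_simp

theorem IsAdmissible.one_le {f : ℝ → ℝ} (hf : IsAdmissible f) {l : ℕ} (hl : 1 ≤ l) :
    1 ≤ f l := by
  have h1 : (1 : ℝ) ≤ l := by exact_mod_cast hl
  have := hf.strictMonoOn.monotoneOn (Set.mem_Ici.2 le_rfl) (Set.mem_Ici.2 h1) h1
  rwa [hf.map_one] at this

variable {f : ℝ → ℝ}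

theorem isGood_zero : IsGood (iterNorm f 0) := by
  have bdd : ∀ x : ℕ →₀ ℝ, BddAbove (Set.range fun n => |x n|) := fun x =>
    ⟨oneNorm x, by rintro _ ⟨n, rfl⟩; exact abs_le_oneNorm x n⟩
  have h0 : ∀ x, 0 ≤ iterNorm f 0 x := fun x => Real.iSup_nonneg fun _ => abs_nonneg _
  have hle : ∀ (x : ℕ →₀ ℝ) n, |x n| ≤ iterNorm f 0 x := fun x n => le_ciSup (bdd x) n
  refine ⟨h0, fun x => ciSup_le fun n => abs_le_oneNorm x n, fun x y => ciSup_le fun n => ?_,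
    smul_eq_of_le h0 fun a x => ciSup_le fun n => ?_, fun E x => ciSup_le fun n => ?_⟩
  · exact (abs_add_le _ _).trans (add_le_add (hle x n) (hle y n))
  · rw [Finsupp.smul_apply, smul_eq_mul, abs_mul]
    exact mul_le_mul_of_nonneg_left (hle x n) (abs_nonneg _)
  · rw [restr_apply]
    split_ifs
    · exact hle x n
    · simpa using h0 x

theorem isGood_succ (hf : IsAdmissible f) {k : ℕ} (h : IsGood (iterNorm f k)) :
    IsGood (iterNorm f (k + 1)) := by
  have key : ∀ (x : ℕ →₀ ℝ) (l : ℕ), 1 ≤ l → ∀ E : Fin l → Finset ℕ, Successive E →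
      1 / f l * ∑ i, iterNorm f k (restr (E i) x) ≤ oneNorm x := fun x l hl E hE => by
    have h1 := hf.one_le hl
    calc 1 / f l * ∑ i, iterNorm f k (restr (E i) x)
        ≤ 1 * ∑ i, iterNorm f k (restr (E i) x) := by
          refine mul_le_mul_of_nonneg_right ?_ (Finset.sum_nonneg fun _ _ => h.nonneg _)
          rw [div_le_one (by linarith)]; exact h1
      _ ≤ ∑ i, oneNorm (restr (E i) x) := by
          rw [one_mul]; exact Finset.sum_le_sum fun _ _ => h.le_one _
      _ ≤ oneNorm x := sum_oneNorm_le E hE x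
  have hle : ∀ (x : ℕ →₀ ℝ) (l : ℕ), 1 ≤ l → ∀ E : Fin l → Finset ℕ, Successive E →
      1 / f l * ∑ i, iterNorm f k (restr (E i) x) ≤ iterNorm f (k + 1) x := fun x l hl E hE =>
    le_csSup ⟨oneNorm x, by rintro _ ⟨l, hl, E, hE, rfl⟩; exact key x l hl E hE⟩
      ⟨l, hl, E, hE, rfl⟩
  have hpos : ∀ l : ℕ, 1 ≤ l → 0 ≤ 1 / f l := fun l hl => by
    have := hf.one_le hl; positivity
  have h0 : ∀ x, 0 ≤ iterNorm f (k + 1) x := fun x => Real.sSup_nonneg (by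
    rintro _ ⟨l, hl, E, hE, rfl⟩
    exact mul_nonneg (hpos l hl) (Finset.sum_nonneg fun _ _ => h.nonneg _))
  have hsup : ∀ (x : ℕ →₀ ℝ) (B : ℝ), (∀ l : ℕ, 1 ≤ l → ∀ E : Fin l → Finset ℕ, Successive E →
      1 / f l * ∑ i, iterNorm f k (restr (E i) x) ≤ B) → iterNorm f (k + 1) x ≤ B :=
    fun x B hB => csSup_le
      ⟨_, 1, le_rfl, fun _ => ∅, fun i j _ a ha => absurd ha (Finset.notMem_empty a), rfl⟩
      (by rintro _ ⟨l, hl, E, hE, rfl⟩; exact hB l hl E hE)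
  refine ⟨h0, fun x => hsup x _ (key x), fun x y => hsup _ _ fun l hl E hE => ?_,
    smul_eq_of_le h0 fun a x => hsup _ _ fun l hl E hE => ?_,
    fun F x => hsup _ _ fun l hl E hE => ?_⟩
  · refine le_trans ?_ (add_le_add (hle x l hl E hE) (hle y l hl E hE))
    rw [← mul_add, ← Finset.sum_add_distrib]
    refine mul_le_mul_of_nonneg_left (Finset.sum_le_sum fun i _ => ?_) (hpos l hl)
    rw [restr_add]; exact h.add_le _ _
  · refine le_trans (le_of_eq ?_) (mul_le_mul_of_nonneg_left (hle x l hl E hE) (abs_nonneg a))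
    simp only [restr_smul, h.smul_eq, ← Finset.mul_sum]
    ring
  · simp only [restr_restr]
    exact hle x l hl (fun i => E i ∩ F) fun i j hij a ha b hb =>
      hE i j hij a (Finset.mem_inter.1 ha).1 b (Finset.mem_inter.1 hb).1

theorem isGood_iterNorm (hf : IsAdmissible f) : ∀ k, IsGood (iterNorm f k)
  | 0 => isGood_zero
  | k + 1 => isGood_succ hf (isGood_iterNorm hf k)

theorem iterNorm_le_limNorm (hf : IsAdmissible f) (k : ℕ) (x : ℕ →₀ ℝ) :
    iterNorm f k x ≤ limNorm f x :=
  le_ciSup (f := fun k => iterNorm f k x)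
    ⟨oneNorm x, by rintro _ ⟨k, rfl⟩; exact (isGood_iterNorm hf k).le_one x⟩ k

theorem isGood_limNorm (hf : IsAdmissible f) : IsGood (limNorm f) := by
  have h := isGood_iterNorm hf
  have hle := iterNorm_le_limNorm hf
  have h0 : ∀ x, 0 ≤ limNorm f x := fun x => Real.iSup_nonneg fun k => (h k).nonneg x
  refine ⟨h0, fun x => ciSup_le fun k => (h k).le_one x, fun x y => ciSup_le fun k => ?_,
    smul_eq_of_le h0 fun a x => ciSup_le fun k => ?_, fun E x => ciSup_le fun k => ?_⟩
  · exact ((h k).add_le x y).trans (add_le_add (hle k x) (hle k y))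
  · rw [(h k).smul_eq]
    exact mul_le_mul_of_nonneg_left (hle k x) (abs_nonneg _)
  · exact ((h k).restr_le E x).trans (hle k x)

theorem limNorm_eq_zero (hf : IsAdmissible f) {x : ℕ →₀ ℝ} : limNorm f x = 0 ↔ x = 0 := by
  constructor
  · intro hx
    ext n
    have h1 : |x n| ≤ iterNorm f 0 x := le_ciSup (f := fun n => |x n|)
      ⟨oneNorm x, by rintro _ ⟨n, rfl⟩; exact abs_le_oneNorm x n⟩ n
    have h2 := h1.trans (iterNorm_le_limNorm hf 0 x)
    rw [hx] at h2
    simpa using h2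
  · rintro rfl
    refine le_antisymm ?_ ((isGood_limNorm hf).nonneg 0)
    simpa [oneNorm] using (isGood_limNorm hf).le_one 0

end Aux

/-- The vector space `c₀₀` of finitely supported real sequences, to be normed by `limNorm f`. -/
def C00 (f : ℝ → ℝ) (_hf : IsAdmissible f) : Type := ℕ →₀ ℝ

namespace C00

variable (f : ℝ → ℝ) (hf : IsAdmissible f)

instance : AddCommGroup (C00 f hf) := inferInstanceAs (AddCommGroup (ℕ →₀ ℝ))

instance : Module ℝ (C00 f hf) := inferInstanceAs (Module ℝ (ℕ →₀ ℝ))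

instance : Norm (C00 f hf) := ⟨limNorm f⟩

theorem core : NormedSpace.Core ℝ (C00 f hf) where
  norm_nonneg := (isGood_limNorm hf).nonneg
  norm_smul := (isGood_limNorm hf).smul_eq
  norm_triangle := (isGood_limNorm hf).add_le
  norm_eq_zero_iff _ := limNorm_eq_zero hf

instance : NormedAddCommGroup (C00 f hf) := NormedAddCommGroup.ofCore (core f hf)

instance : NormedSpace ℝ (C00 f hf) := NormedSpace.ofCore (core f hf)

/-- `x ↦ E(x)` as a bounded operator on `c₀₀`. -/
def restrL (E : Finset ℕ) : C00 f hf →L[ℝ] C00 f hf :=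
  LinearMap.mkContinuous
    { toFun := restr E
      map_add' := restr_add E
      map_smul' := restr_smul E } 1
    fun x => by rw [one_mul]; exact (isGood_limNorm hf).restr_le E x

end C00

/-- The space `X`: the completion of `c₀₀` with respect to `limNorm f`. -/
abbrev XSpace (f : ℝ → ℝ) (hf : IsAdmissible f) : Type := UniformSpace.Completion (C00 f hf)

/-- `x ↦ E(x)` on `X`, the continuous extension of the operator on `c₀₀`. -/
def XSpace.restrL {f : ℝ → ℝ} {hf : IsAdmissible f} (E : Finset ℕ) :
    XSpace f hf →L[ℝ] XSpace f hf :=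
  (C00.restrL f hf E).completion

/-- `‖x‖_ℓ = sup_{E₁ < ⋯ < E_ℓ} (1 / f ℓ) ∑_{i ≤ ℓ} ‖E_i(x)‖` for `x ∈ X`. -/
def XSpace.lNorm {f : ℝ → ℝ} {hf : IsAdmissible f} (l : ℕ) (x : XSpace f hf) : ℝ :=
  sSup {r : ℝ | ∃ E : Fin l → Finset ℕ, Successive E ∧
    r = 1 / f l * ∑ i, ‖XSpace.restrL (E i) x‖}

end

/-! Both unit vectors come from averages. In $X$, $\sum_{j\le m}\|E_j(x)\|\le f(m)\|x\|$ for
successive $E_j$, so $n$ successive unit vectors have a sum of norm at least $n/f(n)$. Since $f$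
grows slower than every power, a blocking argument in the style of James (`exists_isAverage`)
produces, for all $N$ and $C>1$, normalized block sums that split into $N$ successive pieces of norm
at most $C/N$.

Cutting such an average by $m$ successive sets gives total norm at most $C(1+m/N)$
(`IsAverage.sum_le`). With $N$ much larger than $\ell$ this makes $\|\cdot\|_\ell$ nearly as small
as $1/f(\ell)$, which yields $z_2$.

For $z_1$, add $\ell$ successive averages whose lengths increase rapidly. Cutting between them shows
$\|x\|_\ell\ge\ell/f(\ell)$ for the sum $x$. The core is the matching bound
$\|x\|\le(1+\varepsilon)\ell/f(\ell)$ (`exists_limNorm_sum_le`). A cut into many sets is efficient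
for at most one of the averages, hence gains almost nothing. For cuts into few sets, $x$ behaves
like a function of constant density on an interval of length $\ell$, and an induction over the norms
$|\cdot|_k$ (`iterNorm_le_of_length`) bounds a part of length $t\ge1$ by about $t/f(t)$, using
concavity of $t/f(t)$ and submultiplicativity of $f$.

All vectors are built in $c_{00}$ close to the given subspace and then replaced by nearby elements
of it. -/

/-! ### The example $\log_2(x+1)$. -/

theorem isAdmissible_logb : IsAdmissible (fun x : ℝ => Real.logb 2 (x + 1)) where
  map_one := by norm_num
  lt_self x hx := by
    rw [Real.logb_lt_iff_lt_rpow (by norm_num) (by linarith)]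
    have := one_add_mul_self_lt_rpow_one_add (s := 1) (by norm_num) (by norm_num) hx
    norm_num at this
    linarith
  strictMonoOn x hx y hy hxy := by
    simp only [Set.mem_Ici] at hx hy
    exact Real.logb_lt_logb (by norm_num) (by linarith) (by linarith)
  tendsto_atTop :=
    (Real.tendsto_logb_atTop (by norm_num)).comp (Filter.tendsto_atTop_add_const_right _ _
      Filter.tendsto_id)
  tendsto_div_rpow q hq := by
    have h1 : Filter.Tendsto (fun x : ℝ => Real.log (x + 1) / (x + 1) ^ q) Filter.atTop (nhds 0) :=
      ((isLittleO_log_rpow_atTop hq).tendsto_div_nhds_zero).comp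
        (Filter.tendsto_atTop_add_const_right _ 1 Filter.tendsto_id)
    have h2 := h1.const_mul (2 ^ q / Real.log 2)
    rw [mul_zero] at h2
    have hlog : 0 < Real.log 2 := Real.log_pos (by norm_num)
    refine squeeze_zero' ?_ ?_ h2
    · filter_upwards [Filter.eventually_ge_atTop 1] with x hx
      exact div_nonneg (Real.logb_nonneg (by norm_num) (by linarith)) (by positivity)
    · filter_upwards [Filter.eventually_ge_atTop 1] with x hx
      have h3 : (x + 1) ^ q ≤ 2 ^ q * x ^ q := by
        rw [← Real.mul_rpow (by norm_num) (by linarith)]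
        exact Real.rpow_le_rpow (by linarith) (by linarith) hq.le
      have h4 : 0 ≤ Real.log (x + 1) := Real.log_nonneg (by linarith)
      have h5 : 0 < (x + 1) ^ q := Real.rpow_pos_of_pos (by linarith) q
      have h6 : 0 < x ^ q := Real.rpow_pos_of_pos (by linarith) q
      rw [Real.logb, div_div, div_mul_div_comm, div_le_div_iff₀ (by positivity) (by positivity)]
      calc Real.log (x + 1) * (Real.log 2 * (x + 1) ^ q)
          ≤ Real.log (x + 1) * (Real.log 2 * (2 ^ q * x ^ q)) := by gcongr
        _ = _ := by ring
  concaveOn := by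
    -- This integral representation gives concavity: each $x\mapsto(x+1)^s$ with $0\le s\le1$ is
    -- concave.
    have hint : ∀ x : ℝ, 1 ≤ x →
        x / Real.logb 2 (x + 1) = Real.log 2 * ∫ s in (0 : ℝ)..1, (x + 1) ^ s := fun x hx => by
      have hlog : 0 < Real.log (x + 1) := Real.log_pos (by linarith)
      have hpos : 0 < x + 1 := by linarith
      have h1 : ∫ s in (0 : ℝ)..1, (x + 1) ^ s = x / Real.log (x + 1) := by
        have hd : ∀ s ∈ Set.uIcc (0 : ℝ) 1,
            HasDerivAt (fun s : ℝ => (x + 1) ^ s / Real.log (x + 1)) ((x + 1) ^ s) s :=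
          fun s _ => by
            have := (Real.hasStrictDerivAt_const_rpow hpos s).hasDerivAt.div_const
              (Real.log (x + 1))
            rwa [mul_div_cancel_right₀ _ hlog.ne'] at this
        rw [intervalIntegral.integral_eq_sub_of_hasDerivAt hd]
        · rw [Real.rpow_one, Real.rpow_zero]; ring
        · exact (Continuous.intervalIntegrable
            (Real.continuous_const_rpow hpos.ne') _ _)
      rw [h1, Real.logb]
      field_simp
    have hII : ∀ x : ℝ, 1 ≤ x →
        IntervalIntegrable (fun s : ℝ => (x + 1) ^ s) MeasureTheory.volume 0 1 := fun x hx =>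
      (Real.continuous_const_rpow (by linarith : x + 1 ≠ 0)).intervalIntegrable _ _
    refine ⟨convex_Ici 1, fun x hx y hy a b ha hb hab => ?_⟩
    have hz : a • x + b • y ∈ Set.Ici (1 : ℝ) := convex_Ici 1 hx hy ha hb hab
    simp only [Set.mem_Ici, smul_eq_mul] at hx hy hz ⊢
    rw [hint x hx, hint y hy, hint _ hz]
    have hlog : 0 < Real.log 2 := Real.log_pos (by norm_num)
    calc a * (Real.log 2 * ∫ s in (0 : ℝ)..1, (x + 1) ^ s) +
          b * (Real.log 2 * ∫ s in (0 : ℝ)..1, (y + 1) ^ s)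
        = Real.log 2 * ∫ s in (0 : ℝ)..1, (a * (x + 1) ^ s + b * (y + 1) ^ s) := by
          rw [intervalIntegral.integral_add ((hII x hx).const_mul a) ((hII y hy).const_mul b),
            intervalIntegral.integral_const_mul, intervalIntegral.integral_const_mul]
          ring
      _ ≤ _ := by
          refine mul_le_mul_of_nonneg_left ?_ hlog.le
          refine intervalIntegral.integral_mono_on zero_le_one
            (((hII x hx).const_mul a).add ((hII y hy).const_mul b)) (hII _ hz) fun s hs => ?_
          have hc := (Real.concaveOn_rpow hs.1 hs.2).2 (x := x + 1) (y := y + 1)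
            (by simp only [Set.mem_Ici]; linarith) (by simp only [Set.mem_Ici]; linarith) ha hb hab
          simp only [smul_eq_mul] at hc
          refine hc.trans (le_of_eq ?_)
          congr 1
          linear_combination hab
  le_mul x y hx hy := by
    set a := Real.logb 2 (x + 1) with ha
    have hxa : (2 : ℝ) ^ a = x + 1 := Real.rpow_logb (by norm_num) (by norm_num) (by linarith)
    have ha1 : 1 ≤ a := by
      rw [ha, Real.le_logb_iff_rpow_le (by norm_num) (by linarith)]; norm_num; linarith
    have hy0 : 0 < y := by linarith
    have hw : 0 ≤ 1 - 1 / y := by rw [sub_nonneg, div_le_one hy0]; exact hy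
    have hw' : 0 ≤ 1 / y := by positivity
    -- Convexity of $t\mapsto t^a$ at $2=(1-1/y)\cdot1+(1/y)(y+1)$: as $2^a=x+1$, this gives
    -- $xy+1\le(y+1)^a$, whose logarithm is the claim.
    have hc := (convexOn_rpow ha1).2 (Set.mem_Ici.2 zero_le_one)
      (Set.mem_Ici.2 (by linarith : 0 ≤ y + 1)) hw hw' (by ring)
    have h2 : (1 - 1 / y) • (1 : ℝ) + (1 / y) • (y + 1) = 2 := by
      simp only [smul_eq_mul]; field_simp; ring
    simp only [h2, hxa, Real.one_rpow] at hc
    simp only [smul_eq_mul] at hc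
    have h3 : x * y + 1 ≤ (y + 1) ^ a := by
      have := mul_le_mul_of_nonneg_left hc hy0.le
      have h4 : y * ((1 - 1 / y) * 1 + 1 / y * (y + 1) ^ a) = y - 1 + (y + 1) ^ a := by
        field_simp
      rw [h4] at this
      linarith
    calc Real.logb 2 (x * y + 1) ≤ Real.logb 2 ((y + 1) ^ a) :=
          Real.logb_le_logb_of_le (by norm_num) (by positivity) h3
      _ = a * Real.logb 2 (y + 1) := Real.logb_rpow_eq_mul_logb_of_pos (by linarith)

/-! ### Analytic consequences of admissibility. -/

/-- The concave function equal to `t` on `[0, 1]` and to `t / f t` on `[1, ∞)`. -/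
noncomputable def profile (f : ℝ → ℝ) (t : ℝ) : ℝ := if t ≤ 1 then t else t / f t

namespace IsAdmissible

variable {f : ℝ → ℝ}

theorem one_le_real (hf : IsAdmissible f) {x : ℝ} (hx : 1 ≤ x) : 1 ≤ f x := by
  have := hf.strictMonoOn.monotoneOn (Set.mem_Ici.2 le_rfl) (Set.mem_Ici.2 hx) hx
  rwa [hf.map_one] at this

theorem pos_nat (hf : IsAdmissible f) {l : ℕ} (hl : 1 ≤ l) : 0 < f l :=
  zero_lt_one.trans_le (hf.one_le hl)

theorem monotone_nat (hf : IsAdmissible f) {l m : ℕ} (hl : 1 ≤ l) (h : l ≤ m) : f l ≤ f m :=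
  hf.strictMonoOn.monotoneOn (Set.mem_Ici.2 (by exact_mod_cast hl))
    (Set.mem_Ici.2 (by exact_mod_cast hl.trans h)) (by exact_mod_cast h)

theorem one_lt_two (hf : IsAdmissible f) : 1 < f (2 : ℕ) := by
  have := hf.strictMonoOn (a := 1) (b := 2) (by simp) (by simp) (by norm_num)
  rw [hf.map_one] at this
  exact_mod_cast this

theorem exists_nat_le (hf : IsAdmissible f) (c : ℝ) : ∃ M : ℕ, 1 ≤ M ∧ ∀ m ≥ M, c ≤ f m := by
  have h := (hf.tendsto_atTop.comp (tendsto_natCast_atTop_atTop (R := ℝ))).eventually_ge_atTop c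
  obtain ⟨M, hM⟩ := Filter.eventually_atTop.1 h
  exact ⟨max M 1, le_max_right _ _, fun m hm => hM m ((le_max_left _ _).trans hm)⟩

/-- A concave function that decreased somewhere would have slope at most $-c<0$ from there on and
become negative; `z` is chosen so far out that the value drops to $-1$ or below. -/
theorem monotoneOn_div (hf : IsAdmissible f) : MonotoneOn (fun x => x / f x) (Set.Ici 1) := by
  intro x hx y hy hxy
  by_contra! hlt
  have hxy' : x < y := lt_of_le_of_ne hxy (by rintro rfl; exact lt_irrefl _ hlt)
  simp only [Set.mem_Ici] at hx hy
  set c := (x / f x - y / f y) / (y - x) with hc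
  have hc0 : 0 < c := div_pos (by linarith) (by linarith)
  have hfy : 0 < f y := zero_lt_one.trans_le (hf.one_le_real hy)
  set z := y + (y / f y + 1) / c with hz
  have hyz : y < z := by
    have : 0 < (y / f y + 1) / c := by positivity
    linarith
  have hs := hf.concaveOn.slope_anti_adjacent (x := x) (y := y) (z := z) hx
    (by simp only [Set.mem_Ici]; linarith) hxy' hyz
  have h1 : (y / f y - x / f x) / (y - x) = -c := by rw [hc]; ring
  rw [h1, div_le_iff₀ (by linarith)] at hs
  have h2 : -c * (z - y) = -(y / f y + 1) := by rw [hz]; field_simp; ring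
  rw [h2] at hs
  have hfz : 0 < f z := zero_lt_one.trans_le (hf.one_le_real (by linarith))
  have : 0 ≤ z / f z := by apply div_nonneg <;> linarith
  linarith

theorem div_le_self (hf : IsAdmissible f) {x : ℝ} (hx : 1 ≤ x) : x / f x ≤ x :=
  _root_.div_le_self (by linarith) (hf.one_le_real hx)

theorem one_le_div (hf : IsAdmissible f) {x : ℝ} (hx : 1 ≤ x) : 1 ≤ x / f x := by
  have := hf.monotoneOn_div (Set.mem_Ici.2 le_rfl) (Set.mem_Ici.2 hx) hx
  simpa [hf.map_one] using this

theorem profile_of_one_le (hf : IsAdmissible f) {x : ℝ} (hx : 1 ≤ x) : profile f x = x / f x := by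
  rw [profile]
  split_ifs with h
  · rw [le_antisymm h hx, hf.map_one, div_one]
  · rfl

theorem profile_of_le_one {x : ℝ} (hx : x ≤ 1) : profile f x = x := if_pos hx

theorem profile_monotone (hf : IsAdmissible f) : Monotone (profile f) := by
  intro x y hxy
  rcases le_total y 1 with hy | hy
  · rwa [profile_of_le_one hy, profile_of_le_one (hxy.trans hy)]
  · rw [hf.profile_of_one_le hy]
    rcases le_total x 1 with hx | hx
    · rw [profile_of_le_one hx]
      exact hx.trans (hf.one_le_div hy)
    · rw [hf.profile_of_one_le hx]
      exact hf.monotoneOn_div hx hy hxy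

theorem profile_le_self (hf : IsAdmissible f) (x : ℝ) : profile f x ≤ x := by
  rcases le_total x 1 with hx | hx
  · rw [profile_of_le_one hx]
  · rw [hf.profile_of_one_le hx]; exact hf.div_le_self hx

/-- The slope is 1 to the left of 1, and chords to the right have slope at most 1 because the
profile stays below the identity. Chords straddling 1 are compared through the point 1. -/
theorem profile_concaveOn (hf : IsAdmissible f) : ConcaveOn ℝ Set.univ (profile f) := by
  refine concaveOn_of_slope_anti_adjacent convex_univ fun {x y z} _ _ hxy hyz => ?_
  rcases le_total y 1 with hy | hy
  · rw [profile_of_le_one hy, profile_of_le_one (hxy.le.trans hy), div_self (by linarith),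
      div_le_one (by linarith)]
    linarith [hf.profile_le_self z]
  · have hz : 1 ≤ z := hy.trans hyz.le
    have key : ∀ x, 1 ≤ x → x < y →
        (profile f z - profile f y) / (z - y) ≤ (profile f y - profile f x) / (y - x) := fun x hx hxy => by
      rw [hf.profile_of_one_le hx, hf.profile_of_one_le hy, hf.profile_of_one_le hz]
      exact hf.concaveOn.slope_anti_adjacent (Set.mem_Ici.2 hx) (Set.mem_Ici.2 hz) hxy hyz
    rcases le_total 1 x with hx | hx
    · exact key x hx hxy
    · rcases eq_or_lt_of_le hy with rfl | hy'
      · rw [profile_of_le_one le_rfl, profile_of_le_one hx, div_self (by linarith),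
          div_le_one (by linarith)]
        linarith [hf.profile_le_self z]
      · refine (key 1 le_rfl hy').trans ?_
        rw [profile_of_le_one le_rfl, profile_of_le_one hx,
          div_le_div_iff₀ (by linarith) (by linarith)]
        nlinarith [hf.profile_le_self y]

/-- Jensen bounds the sum by $m$ times the profile at $s/m$. If $s\ge m$, submultiplicativity
$f(s)\le f(m)f(s/m)$ finishes; if $s\le m$, monotonicity $f(s)\le f(m)$ does. This makes $t/f(t)$
stable under one step of the recursion for the norms. -/
theorem sum_profile_le (hf : IsAdmissible f) {m : ℕ} (hm : 1 ≤ m) (t : Fin m → ℝ) {s : ℝ}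
    (hs : 1 ≤ s) (hts : ∑ j, t j ≤ s) : ∑ j, profile f (t j) ≤ f m * profile f s := by
  have hm0 : (0 : ℝ) < m := by exact_mod_cast hm
  have hm1 : (1 : ℝ) ≤ m := by exact_mod_cast hm
  have hJ : ∑ j, (1 / m : ℝ) • profile f (t j) ≤ profile f (∑ j, (1 / m : ℝ) • t j) :=
    hf.profile_concaveOn.le_map_sum (fun _ _ => by positivity)
      (by simp [hm0.ne']) (fun _ _ => Set.mem_univ _)
  rw [← Finset.smul_sum, ← Finset.smul_sum, smul_eq_mul, smul_eq_mul] at hJ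
  have h1 : profile f (1 / m * ∑ j, t j) ≤ profile f (s / m) :=
    hf.profile_monotone (by rw [div_mul_eq_mul_div, one_mul]; gcongr)
  have h2 : ∑ j, profile f (t j) ≤ m * profile f (s / m) := by
    have := mul_le_mul_of_nonneg_left (hJ.trans h1) hm0.le
    rwa [← mul_assoc, mul_one_div_cancel hm0.ne', one_mul] at this
  refine h2.trans ?_
  have hfm := hf.pos_nat hm
  have hfs : 0 < f s := zero_lt_one.trans_le (hf.one_le_real hs)
  rw [hf.profile_of_one_le hs]
  rcases le_total (s / m) 1 with h | h
  · rw [profile_of_le_one h, mul_div_cancel₀ _ hm0.ne']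
    rw [div_le_one hm0] at h
    have h3 := hf.strictMonoOn.monotoneOn (Set.mem_Ici.2 hs) (Set.mem_Ici.2 hm1) h
    rw [mul_div_assoc', le_div_iff₀ hfs, mul_comm]
    gcongr
  · have hfsm : 0 < f (s / m) := zero_lt_one.trans_le (hf.one_le_real h)
    have h3 := hf.le_mul m (s / m) hm1 h
    rw [mul_div_cancel₀ _ hm0.ne'] at h3
    rw [hf.profile_of_one_le h, mul_div_assoc', mul_div_cancel₀ _ hm0.ne', mul_div_assoc',
      div_le_div_iff₀ hfsm hfs]
    nlinarith

/-- `f` grows slower than any power, along the powers of `N`. -/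
theorem exists_pow_lt (hf : IsAdmissible f) {N : ℕ} (hN : 2 ≤ N) {C : ℝ} (hC : 1 < C) :
    ∃ k : ℕ, f ((N ^ k : ℕ) : ℝ) < C ^ k := by
  have hN1 : (1 : ℝ) < N := by exact_mod_cast hN
  have hN0 : (0 : ℝ) < N := by linarith
  -- With this exponent $(N^k)^q=C^k$.
  set q := Real.logb N C with hq
  have hq0 : 0 < q := Real.logb_pos hN1 hC
  have h1 : Filter.Tendsto (fun k : ℕ => (N : ℝ) ^ k) Filter.atTop Filter.atTop :=
    tendsto_pow_atTop_atTop_of_one_lt hN1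
  obtain ⟨k, hk⟩ := (((hf.tendsto_div_rpow q hq0).comp h1).eventually_lt_const one_pos).exists
  refine ⟨k, ?_⟩
  simp only [Function.comp_apply] at hk
  rw [div_lt_one (by positivity), ← Real.rpow_natCast (N : ℝ) k, ← Real.rpow_mul hN0.le,
    mul_comm, Real.rpow_mul hN0.le, Real.rpow_logb hN0 hN1.ne' (by linarith),
    Real.rpow_natCast, Real.rpow_natCast] at hk
  exact_mod_cast hk

end IsAdmissible

/-! ### Basic inequalities for the norms on $c_{00}$. -/

section Norm

variable {f : ℝ → ℝ}

theorem restr_eq_self {E : Finset ℕ} {x : ℕ →₀ ℝ} (h : x.support ⊆ E) : restr E x = x := by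
  ext n
  rw [restr_apply]
  split_ifs with hn
  · rfl
  · exact (Finsupp.notMem_support_iff.1 fun h' => hn (h h')).symm

theorem restr_eq_zero {E : Finset ℕ} {x : ℕ →₀ ℝ} (h : ∀ n ∈ E, n ∉ x.support) :
    restr E x = 0 := by
  ext n
  rw [restr_apply]
  split_ifs with hn
  · exact Finsupp.notMem_support_iff.1 (h n hn)
  · rfl

theorem restr_empty (x : ℕ →₀ ℝ) : restr ∅ x = 0 := restr_eq_zero (by simp)

theorem restr_sum {ι : Type*} (E : Finset ℕ) (s : Finset ι) (u : ι → ℕ →₀ ℝ) :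
    restr E (∑ i ∈ s, u i) = ∑ i ∈ s, restr E (u i) :=
  map_sum (AddMonoidHom.mk' (restr E) (restr_add E)) u s

theorem support_restr_subset (E : Finset ℕ) (x : ℕ →₀ ℝ) : (restr E x).support ⊆ E := by
  intro n hn
  rw [Finsupp.mem_support_iff, restr_apply] at hn
  by_contra h
  simp [h] at hn

theorem IsGood.sum_le {N : (ℕ →₀ ℝ) → ℝ} (h : IsGood N) {ι : Type*} (s : Finset ι)
    (u : ι → ℕ →₀ ℝ) : N (∑ i ∈ s, u i) ≤ ∑ i ∈ s, N (u i) := by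
  refine Finset.le_sum_of_subadditive N ?_ h.add_le s u
  exact le_of_eq (by simpa using h.smul_eq 0 0)

theorem IsGood.map_zero {N : (ℕ →₀ ℝ) → ℝ} (h : IsGood N) : N 0 = 0 := by
  simpa using h.smul_eq 0 0

theorem Successive.inter {m : ℕ} {E : Fin m → Finset ℕ} (hE : Successive E) (F : Finset ℕ) :
    Successive fun j => E j ∩ F := fun i j hij a ha b hb =>
  hE i j hij a (Finset.mem_inter.1 ha).1 b (Finset.mem_inter.1 hb).1

theorem abs_apply_le_iterNorm_zero (x : ℕ →₀ ℝ) (n : ℕ) : |x n| ≤ iterNorm f 0 x :=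
  le_ciSup (f := fun n => |x n|)
    ⟨oneNorm x, by rintro _ ⟨n, rfl⟩; exact abs_le_oneNorm x n⟩ n

theorem abs_apply_le_limNorm (hf : IsAdmissible f) (x : ℕ →₀ ℝ) (n : ℕ) : |x n| ≤ limNorm f x :=
  (abs_apply_le_iterNorm_zero x n).trans (iterNorm_le_limNorm hf 0 x)

theorem sum_iterNorm_le_oneNorm (hf : IsAdmissible f) (k : ℕ) (x : ℕ →₀ ℝ) {m : ℕ}
    {E : Fin m → Finset ℕ} (hE : Successive E) :
    ∑ j, iterNorm f k (restr (E j) x) ≤ oneNorm x :=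
  (Finset.sum_le_sum fun _ _ => (isGood_iterNorm hf k).le_one _).trans (sum_oneNorm_le E hE x)

theorem sum_iterNorm_le (hf : IsAdmissible f) (k : ℕ) (x : ℕ →₀ ℝ) {m : ℕ} (hm : 1 ≤ m)
    {E : Fin m → Finset ℕ} (hE : Successive E) :
    ∑ j, iterNorm f k (restr (E j) x) ≤ f m * iterNorm f (k + 1) x := by
  have hle : 1 / f m * ∑ j, iterNorm f k (restr (E j) x) ≤ iterNorm f (k + 1) x := by
    refine le_csSup ⟨oneNorm x, ?_⟩ ⟨m, hm, E, hE, rfl⟩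
    rintro _ ⟨l, hl, E, hE, rfl⟩
    have h1 := hf.one_le hl
    have h0 : 0 ≤ ∑ i, iterNorm f k (restr (E i) x) :=
      Finset.sum_nonneg fun _ _ => (isGood_iterNorm hf k).nonneg _
    rw [div_mul_eq_mul_div, one_mul]
    exact (div_le_self h0 h1).trans (sum_iterNorm_le_oneNorm hf k x hE)
  rwa [div_mul_eq_mul_div, one_mul, div_le_iff₀ (hf.pos_nat hm), mul_comm] at hle

theorem iterNorm_succ_le (hf : IsAdmissible f) {k : ℕ} {x : ℕ →₀ ℝ} {B : ℝ}
    (h : ∀ m : ℕ, 1 ≤ m → ∀ E : Fin m → Finset ℕ, Successive E →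
      ∑ j, iterNorm f k (restr (E j) x) ≤ f m * B) : iterNorm f (k + 1) x ≤ B := by
  refine csSup_le ⟨_, 1, le_rfl, fun _ => ∅,
    fun i j _ a ha => absurd ha (Finset.notMem_empty a), rfl⟩ ?_
  rintro _ ⟨m, hm, E, hE, rfl⟩
  rw [div_mul_eq_mul_div, one_mul, div_le_iff₀ (hf.pos_nat hm), mul_comm B]
  exact h m hm E hE

theorem successive_of_subsingleton {m : ℕ} (hm : m ≤ 1) (E : Fin m → Finset ℕ) :
    Successive E := fun i j hij => by
  have := i.2; have := j.2; have : i.1 < j.1 := hij; omega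

theorem iterNorm_monotone (hf : IsAdmissible f) (x : ℕ →₀ ℝ) :
    Monotone fun k => iterNorm f k x := by
  refine monotone_nat_of_le_succ fun k => ?_
  have := sum_iterNorm_le hf k x le_rfl
    (successive_of_subsingleton le_rfl fun _ : Fin 1 => x.support)
  simpa [restr_eq_self, hf.map_one] using this

theorem tendsto_iterNorm (hf : IsAdmissible f) (x : ℕ →₀ ℝ) :
    Filter.Tendsto (fun k => iterNorm f k x) Filter.atTop (nhds (limNorm f x)) :=
  tendsto_atTop_ciSup (iterNorm_monotone hf x)
    ⟨oneNorm x, by rintro _ ⟨k, rfl⟩; exact (isGood_iterNorm hf k).le_one x⟩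

theorem sum_limNorm_le_oneNorm (hf : IsAdmissible f) (x : ℕ →₀ ℝ) {m : ℕ}
    {E : Fin m → Finset ℕ} (hE : Successive E) :
    ∑ j, limNorm f (restr (E j) x) ≤ oneNorm x :=
  (Finset.sum_le_sum fun _ _ => (isGood_limNorm hf).le_one _).trans (sum_oneNorm_le E hE x)

/-- The limit $k\to\infty$ of the recursion. This is the lower half of the implicit equation for the
norm; upper estimates go through the $|\cdot|_k$. -/
theorem sum_limNorm_le (hf : IsAdmissible f) (x : ℕ →₀ ℝ) {m : ℕ} (hm : 1 ≤ m)
    {E : Fin m → Finset ℕ} (hE : Successive E) :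
    ∑ j, limNorm f (restr (E j) x) ≤ f m * limNorm f x := by
  refine le_of_tendsto' (tendsto_finsetSum _ fun j _ => tendsto_iterNorm hf (restr (E j) x))
    fun k => (sum_iterNorm_le hf k x hm hE).trans ?_
  exact mul_le_mul_of_nonneg_left (iterNorm_le_limNorm hf _ x) (hf.pos_nat hm).le

end Norm

/-! ### Averages and their existence among block sums. -/

section Average

variable {f : ℝ → ℝ}

/-- The number of the points `q 0, ..., q (N - 1)` which separate two elements of `E`. -/
def crossCard (q : ℕ → ℕ) (N : ℕ) (E : Finset ℕ) : ℕ :=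
  ((Finset.range N).filter fun r => ∃ a ∈ E, ∃ b ∈ E, a < q r ∧ q r ≤ b).card

theorem crossCard_le (q : ℕ → ℕ) (N : ℕ) (E : Finset ℕ) : crossCard q N E ≤ N :=
  (Finset.card_filter_le _ _).trans (by simp)

/-- A point separating two elements of one of the sets cannot separate two elements of a later one,
so the sets of points counted are disjoint. Thus crossing numbers act as a superadditive length. -/
theorem sum_crossCard_le (q : ℕ → ℕ) (N : ℕ) {m : ℕ} {E : Fin m → Finset ℕ} (hE : Successive E)
    {F : Finset ℕ} (hF : ∀ j, E j ⊆ F) : ∑ j, crossCard q N (E j) ≤ crossCard q N F := by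
  unfold crossCard
  rw [← Finset.card_biUnion]
  · refine Finset.card_le_card fun r hr => ?_
    simp only [Finset.mem_biUnion, Finset.mem_filter] at hr ⊢
    obtain ⟨j, _, hr, a, ha, b, hb, h⟩ := hr
    exact ⟨hr, a, hF j ha, b, hF j hb, h⟩
  · have key : ∀ i j : Fin m, i < j → ∀ r, (∃ a ∈ E i, ∃ b ∈ E i, a < q r ∧ q r ≤ b) →
        ¬ ∃ a ∈ E j, ∃ b ∈ E j, a < q r ∧ q r ≤ b := by
      rintro i j hij r ⟨a, ha, b, hb, h1, h2⟩ ⟨a', ha', b', hb', h1', h2'⟩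
      have := hE i j hij b hb a' ha'
      omega
    intro i _ j _ hij
    refine Finset.disjoint_left.2 fun r hr hr' => ?_
    have hr := (Finset.mem_filter.1 hr).2
    have hr' := (Finset.mem_filter.1 hr').2
    rcases lt_or_gt_of_ne hij with h | h
    · exact key i j h r hr hr'
    · exact key j i h r hr' hr

theorem sum_restr_Ico {q : ℕ → ℕ} (hq : Monotone q) (N : ℕ) (y : ℕ →₀ ℝ) :
    ∑ r ∈ Finset.range N, restr (Finset.Ico (q r) (q (r + 1))) y =
      restr (Finset.Ico (q 0) (q N)) y := by
  induction N with
  | zero => simp [restr_empty]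
  | succ N ih =>
    rw [Finset.sum_range_succ, ih]
    ext n
    have h1 := hq (Nat.zero_le N)
    have h2 := hq (Nat.le_succ N)
    simp only [Finsupp.add_apply, restr_apply, Finset.mem_Ico, Nat.succ_eq_add_one] at *
    split_ifs <;> first | omega | simp

/-- The number of intervals `[q r, q (r + 1))` met by `E` is at most `crossCard q N E + 1`. -/
theorem card_meet_le {q : ℕ → ℕ} (hq : Monotone q) (N : ℕ) (E : Finset ℕ) :
    ((Finset.range N).filter fun r => (E ∩ Finset.Ico (q r) (q (r + 1))).Nonempty).card ≤
      crossCard q N E + 1 := by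
  set T := (Finset.range N).filter fun r => (E ∩ Finset.Ico (q r) (q (r + 1))).Nonempty with hT
  rcases T.eq_empty_or_nonempty with h | h
  · simp [h]
  · have hsub : T.erase (T.min' h) ⊆
        (Finset.range N).filter fun r => ∃ a ∈ E, ∃ b ∈ E, a < q r ∧ q r ≤ b := by
      intro r hr
      have hlt : T.min' h < r := Finset.min'_lt_of_mem_erase_min' T h hr
      have hrT := Finset.mem_of_mem_erase hr
      obtain ⟨hrN, b, hb⟩ := Finset.mem_filter.1 hrT
      obtain ⟨_, a, ha⟩ := Finset.mem_filter.1 (T.min'_mem h)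
      simp only [Finset.mem_inter, Finset.mem_Ico] at ha hb
      exact Finset.mem_filter.2 ⟨hrN, a, ha.1, b, hb.1,
        ha.2.2.trans_le (hq hlt), hb.2.1⟩
    have := Finset.card_le_card hsub
    rw [Finset.card_erase_of_mem (T.min'_mem h)] at this
    unfold crossCard
    omega

theorem limNorm_restr_le_crossCard (hf : IsAdmissible f) {q : ℕ → ℕ} (hq : Monotone q) {N : ℕ}
    {y : ℕ →₀ ℝ} (hy : y.support ⊆ Finset.Ico (q 0) (q N)) {D : ℝ} (hD : 0 ≤ D)
    (h : ∀ r < N, limNorm f (restr (Finset.Ico (q r) (q (r + 1))) y) ≤ D) (E : Finset ℕ) :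
    limNorm f (restr E y) ≤ D * (crossCard q N E + 1) := by
  have hg := isGood_limNorm hf
  have h1 : restr E y = ∑ r ∈ Finset.range N,
      restr E (restr (Finset.Ico (q r) (q (r + 1))) y) := by
    rw [← restr_sum, sum_restr_Ico hq, restr_eq_self hy]
  calc limNorm f (restr E y)
      ≤ ∑ r ∈ Finset.range N, limNorm f (restr E (restr (Finset.Ico (q r) (q (r + 1))) y)) := by
        rw [h1]; exact hg.sum_le _ _
    _ ≤ ∑ r ∈ Finset.range N,
        if (E ∩ Finset.Ico (q r) (q (r + 1))).Nonempty then D else 0 := by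
        refine Finset.sum_le_sum fun r hr => ?_
        split_ifs with hne
        · exact (hg.restr_le _ _).trans (h r (Finset.mem_range.1 hr))
        · rw [restr_restr, Finset.not_nonempty_iff_eq_empty.1 hne, restr_empty, hg.map_zero]
    _ = D * ((Finset.range N).filter fun r =>
          (E ∩ Finset.Ico (q r) (q (r + 1))).Nonempty).card := by
        rw [← Finset.sum_filter, Finset.sum_const, nsmul_eq_mul, mul_comm]
    _ ≤ D * (crossCard q N E + 1) :=
        mul_le_mul_of_nonneg_left (by exact_mod_cast card_meet_le hq N E) hD

/-- `y` is a sum of `N` successive vectors of norm at most `C / N`. -/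
def IsAverage (f : ℝ → ℝ) (N : ℕ) (C : ℝ) (y : ℕ →₀ ℝ) : Prop :=
  ∃ q : ℕ → ℕ, Monotone q ∧ y.support ⊆ Finset.Ico (q 0) (q N) ∧
    ∀ r < N, limNorm f (restr (Finset.Ico (q r) (q (r + 1))) y) ≤ C / N

/-- An average of unit norm behaves like an average in `ℓ₁`. -/
theorem IsAverage.sum_le (hf : IsAdmissible f) {N : ℕ} (hN : 1 ≤ N) {C : ℝ} (hC : 0 ≤ C)
    {y : ℕ →₀ ℝ} (hy : IsAverage f N C y) {m : ℕ} {E : Fin m → Finset ℕ} (hE : Successive E) :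
    ∑ j, limNorm f (restr (E j) y) ≤ C * (1 + m / N) := by
  obtain ⟨q, hq, hsupp, h⟩ := hy
  have hN0 : (0 : ℝ) < N := by exact_mod_cast hN
  have h1 : (∑ j, (crossCard q N (E j) : ℝ)) ≤ N := by
    exact_mod_cast (sum_crossCard_le q N hE (F := Finset.univ.biUnion E)
      fun j => Finset.subset_biUnion_of_mem E (Finset.mem_univ j)).trans (crossCard_le _ _ _)
  calc ∑ j, limNorm f (restr (E j) y)
      ≤ ∑ j, C / N * (crossCard q N (E j) + 1) := Finset.sum_le_sum fun j _ =>
        limNorm_restr_le_crossCard hf hq hsupp (by positivity) h (E j)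
    _ = C / N * (∑ j, (crossCard q N (E j) : ℝ) + m) := by
        rw [← Finset.mul_sum, Finset.sum_add_distrib]; simp
    _ ≤ C / N * (N + m) := by gcongr
    _ = C * (1 + m / N) := by field_simp

theorem restr_sum_blocks {s : ℕ → ℕ} (hs : Monotone s) {u : ℕ → ℕ →₀ ℝ}
    (hu : ∀ j, (u j).support ⊆ Finset.Ico (s j) (s (j + 1))) {a a' b' b : ℕ} (ha : a ≤ a')
    (hb : b' ≤ b) :
    restr (Finset.Ico (s a') (s b')) (∑ j ∈ Finset.Ico a b, u j) =
      ∑ j ∈ Finset.Ico a' b', u j := by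
  rw [restr_sum, ← Finset.sum_subset (Finset.Ico_subset_Ico ha hb)]
  · refine Finset.sum_congr rfl fun j hj => restr_eq_self ((hu j).trans ?_)
    rw [Finset.mem_Ico] at hj
    exact Finset.Ico_subset_Ico (hs hj.1) (hs hj.2)
  · intro j _ hj
    refine restr_eq_zero fun n hn hn' => hj ?_
    have := hu j hn'
    rw [Finset.mem_Ico] at *
    constructor
    · by_contra! h
      have := hs (show j + 1 ≤ a' from h)
      omega
    · by_contra! h
      have := hs h
      omega

theorem support_sum_blocks {s : ℕ → ℕ} (hs : Monotone s) {u : ℕ → ℕ →₀ ℝ}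
    (hu : ∀ j, (u j).support ⊆ Finset.Ico (s j) (s (j + 1))) (a b : ℕ) :
    (∑ j ∈ Finset.Ico a b, u j).support ⊆ Finset.Ico (s a) (s b) := by
  rw [← restr_sum_blocks hs hu le_rfl le_rfl]
  exact support_restr_subset _ _

theorem limNorm_le_sum_blocks (hf : IsAdmissible f) {s : ℕ → ℕ} (hs : Monotone s)
    {u : ℕ → ℕ →₀ ℝ} (hu : ∀ j, (u j).support ⊆ Finset.Ico (s j) (s (j + 1))) {a b j : ℕ}
    (ha : a ≤ j) (hb : j < b) : limNorm f (u j) ≤ limNorm f (∑ j ∈ Finset.Ico a b, u j) := by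
  have := restr_sum_blocks hs hu ha (show j + 1 ≤ b from hb)
  rw [Nat.Ico_succ_singleton, Finset.sum_singleton] at this
  rw [← this]
  exact (isGood_limNorm hf).restr_le _ _

theorem exists_successive_blocks {s : ℕ → ℕ} (hs : Monotone s)
    {u : ℕ → ℕ →₀ ℝ} (hu : ∀ j, (u j).support ⊆ Finset.Ico (s j) (s (j + 1))) (m : ℕ) :
    ∃ E : Fin m → Finset ℕ, Successive E ∧
      ∀ j, restr (E j) (∑ j ∈ Finset.Ico 0 m, u j) = u j := by
  refine ⟨fun j => Finset.Ico (s j) (s (j + 1)), fun i j hij a ha b hb => ?_, fun j => ?_⟩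
  · have := hs (show (i : ℕ) + 1 ≤ j from hij)
    rw [Finset.mem_Ico] at ha hb
    omega
  · have := restr_sum_blocks hs hu (Nat.zero_le j) (show (j : ℕ) + 1 ≤ m from j.2)
    rwa [Nat.Ico_succ_singleton, Finset.sum_singleton] at this

/-- Among the partial sums of sufficiently many successive unit vectors there is a multiple of an
average with constant `C`. -/
theorem exists_isAverage (hf : IsAdmissible f) {N : ℕ} (hN : 2 ≤ N) {C : ℝ} (hC : 1 < C) {k : ℕ}
    (hk : f ((N ^ k : ℕ) : ℝ) < C ^ k) {s : ℕ → ℕ} (hs : Monotone s) {u : ℕ → ℕ →₀ ℝ}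
    (hu : ∀ j, (u j).support ⊆ Finset.Ico (s j) (s (j + 1))) (hu1 : ∀ j, limNorm f (u j) = 1) :
    ∃ a b, a < b ∧ b ≤ N ^ k ∧
      IsAverage f N C ((limNorm f (∑ j ∈ Finset.Ico a b, u j))⁻¹ • ∑ j ∈ Finset.Ico a b, u j) := by
  by_contra! hcon
  have hg := isGood_limNorm hf
  have hN0 : (0 : ℝ) < N := by exact_mod_cast (by omega : 0 < N)
  have hC0 : 0 < C := by linarith
  have hNk : ∀ i, 0 < N ^ i := fun i => pow_pos (by omega) i
  -- If no block sum is an average, grouping $N$ blocks multiplies the norm bound by at most $N/C$: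
  -- were the norm larger, the $N$ pieces, normalized, would have norm at most $C/N$.
  have key : ∀ i ≤ k, ∀ j, (j + 1) * N ^ i ≤ N ^ k →
      limNorm f (∑ n ∈ Finset.Ico (j * N ^ i) ((j + 1) * N ^ i), u n) ≤ (N / C) ^ i := by
    intro i
    induction i with
    | zero =>
      intro _ j _
      simp [hu1]
    | succ i ih =>
      intro hik j hj
      by_contra! hlt
      set v := ∑ n ∈ Finset.Ico (j * N ^ (i + 1)) ((j + 1) * N ^ (i + 1)), u n with hv
      have hv0 : 0 < limNorm f v := lt_of_le_of_lt (by positivity) hlt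
      refine hcon (j * N ^ (i + 1)) ((j + 1) * N ^ (i + 1))
        (Nat.mul_lt_mul_of_pos_right (by omega) (hNk _)) hj ?_
      rw [← hv]
      refine ⟨fun r => s ((j * N + r) * N ^ i), fun r r' h => hs ?_, ?_, fun r hr => ?_⟩
      · exact Nat.mul_le_mul_right _ (by omega)
      · have h1 : (j * N + 0) * N ^ i = j * N ^ (i + 1) := by ring
        have h2 : (j * N + N) * N ^ i = (j + 1) * N ^ (i + 1) := by ring
        simp only [h1, h2]
        exact Finsupp.support_smul.trans (support_sum_blocks hs hu _ _)
      · have h1 : j * N ^ (i + 1) ≤ (j * N + r) * N ^ i := by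
          rw [pow_succ']; nlinarith [hNk i]
        have h2 : (j * N + r + 1) * N ^ i ≤ (j + 1) * N ^ (i + 1) := by
          calc (j * N + r + 1) * N ^ i ≤ (j * N + N) * N ^ i :=
                Nat.mul_le_mul_right _ (by omega)
            _ = _ := by ring
        have h3 : restr (Finset.Ico (s ((j * N + r) * N ^ i)) (s ((j * N + (r + 1)) * N ^ i))) v =
            ∑ n ∈ Finset.Ico ((j * N + r) * N ^ i) ((j * N + r + 1) * N ^ i), u n :=
          restr_sum_blocks hs hu h1 h2
        rw [restr_smul, hg.smul_eq, h3, abs_inv, abs_of_pos hv0, inv_mul_le_iff₀ hv0]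
        refine (ih (by omega) _ (h2.trans hj)).trans ?_
        calc (N / C : ℝ) ^ i = (N / C) ^ (i + 1) * (C / N) := by
              rw [pow_succ]; field_simp
          _ ≤ limNorm f v * (C / N) := by gcongr
  -- The whole sum then has norm at most $(N/C)^k$, yet cutting it into its $N^k$ unit vectors gives
  -- at least $N^k/f(N^k)$, contradicting $f(N^k)<C^k$.
  have h1 := key k le_rfl 0 (by simp)
  rw [zero_mul, zero_add, one_mul] at h1
  obtain ⟨E, hE, hEu⟩ := exists_successive_blocks hs hu (N ^ k)
  have h2 := sum_limNorm_le hf (∑ j ∈ Finset.Ico 0 (N ^ k), u j) (hNk k) hE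
  simp only [hEu, hu1, Finset.sum_const, Finset.card_univ, Fintype.card_fin, nsmul_eq_mul,
    mul_one] at h2
  have hfN := hf.pos_nat (hNk k)
  have h3 := h2.trans (mul_le_mul_of_nonneg_left h1 hfN.le)
  rw [div_pow, mul_div_assoc', le_div_iff₀ (by positivity)] at h3
  push_cast at h3 hk
  have : (0 : ℝ) < (N : ℝ) ^ k := by positivity
  nlinarith

end Average

/-! ### Upper estimate for sums of rapidly increasing averages. -/

section RapidlyIncreasing

variable {f : ℝ → ℝ}

/-- The induction behind the upper estimate for sums of rapidly increasing averages: `Λ` is a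
length of sets for which `x` looks like a sum of averages at every scale below `M`. -/
theorem iterNorm_le_of_length (hf : IsAdmissible f) {x : ℕ →₀ ℝ} {Λ : Finset ℕ → ℝ}
    (hΛ0 : ∀ E, 0 ≤ Λ E)
    (hΛ : ∀ (m : ℕ) (E : Fin m → Finset ℕ) (F : Finset ℕ), Successive E → (∀ j, E j ⊆ F) →
      ∑ j, Λ (E j) ≤ Λ F)
    (hx : ∀ n, |x n| ≤ 1) {D η A : ℝ} {M : ℕ} (hD : 1 ≤ D) (hη : 0 ≤ η) (hA1 : 1 ≤ A)
    (hA : M ≤ A * (f (2 : ℕ) - 1)) (hshort : ∀ E, limNorm f (restr E x) ≤ D * Λ E + η)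
    (hlong : ∀ m : ℕ, M ≤ m → 1 ≤ m → ∀ E : Fin m → Finset ℕ, Successive E →
      ∑ j, limNorm f (restr (E j) x) ≤ f m * D) (k : ℕ) :
    ∀ F, 1 ≤ Λ F → iterNorm f k (restr F x) ≤ D * profile f (Λ F) + A * η * Λ F := by
  have hp : ∀ t, 1 ≤ t → 1 ≤ profile f t := fun t ht => by
    rw [hf.profile_of_one_le ht]; exact hf.one_le_div ht
  induction k with
  | zero =>
    intro F hF
    have h1 : (1 : ℝ) ≤ D * profile f (Λ F) + A * η * Λ F := by
      have := hp _ hF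
      have h2 : 0 ≤ A * η * Λ F := mul_nonneg (mul_nonneg (by linarith) hη) (hΛ0 F)
      nlinarith
    refine ciSup_le fun n => le_trans ?_ h1
    rw [restr_apply]
    split_ifs
    · exact hx n
    · simp
  | succ k ih =>
    intro F hF
    refine iterNorm_succ_le hf fun m hm E hE => ?_
    simp only [restr_restr]
    have hE' := hE.inter F
    have hsum := hΛ m _ F hE' fun j => Finset.inter_subset_right
    have hpF := hp _ hF
    have hfm := hf.pos_nat hm
    have hAη : 0 ≤ A * η := mul_nonneg (by linarith) hη
    have hAF : 0 ≤ A * η * Λ F := mul_nonneg hAη (hΛ0 F)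
    by_cases hMm : M ≤ m
    · calc ∑ j, iterNorm f k (restr (E j ∩ F) x) ≤ ∑ j, limNorm f (restr (E j ∩ F) x) :=
            Finset.sum_le_sum fun j _ => iterNorm_le_limNorm hf k _
        _ ≤ f m * D := hlong m hMm hm _ hE'
        _ ≤ f m * (D * profile f (Λ F) + A * η * Λ F) := by
            refine mul_le_mul_of_nonneg_left ?_ hfm.le
            nlinarith
    · have hj : ∀ j, iterNorm f k (restr (E j ∩ F) x) ≤
          D * profile f (Λ (E j ∩ F)) + A * η * Λ (E j ∩ F) ∨
          iterNorm f k (restr (E j ∩ F) x) ≤ D * profile f (Λ (E j ∩ F)) + η := fun j => by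
        rcases le_total 1 (Λ (E j ∩ F)) with h | h
        · exact Or.inl (ih _ h)
        · right
          rw [IsAdmissible.profile_of_le_one h]
          exact (iterNorm_le_limNorm hf k _).trans (hshort _)
      rcases eq_or_lt_of_le hm with rfl | hm2
      · have hle : Λ (E 0 ∩ F) ≤ Λ F := by simpa using hsum
        have hmono := hf.profile_monotone hle
        have h1 : η ≤ A * η * Λ F := by nlinarith
        have h2 : A * η * Λ (E 0 ∩ F) ≤ A * η * Λ F := mul_le_mul_of_nonneg_left hle hAη
        have h3 : D * profile f (Λ (E 0 ∩ F)) ≤ D * profile f (Λ F) :=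
          mul_le_mul_of_nonneg_left hmono (by linarith)
        simp only [Nat.cast_one, hf.map_one, one_mul, Finset.univ_unique, Fin.default_eq_zero,
          Finset.sum_singleton]
        rcases hj 0 with h | h <;> linarith
      · have hj' : ∀ j, iterNorm f k (restr (E j ∩ F) x) ≤
            D * profile f (Λ (E j ∩ F)) + A * η * Λ (E j ∩ F) + η := fun j => by
          have := mul_nonneg hAη (hΛ0 (E j ∩ F))
          rcases hj j with h | h <;> linarith
        have hprof := hf.sum_profile_le hm (fun j => Λ (E j ∩ F)) hF hsum
        have hf2 : f (2 : ℕ) ≤ f m := hf.monotone_nat (by norm_num) hm2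
        have hmM : (m : ℝ) ≤ M := by exact_mod_cast (not_le.1 hMm).le
        -- The $m$ new errors $\eta$ are absorbed by the surplus $(f(m)-1)A\eta\Lambda(F)$; $A$ is
        -- large enough for this since $m\le M$, $f(m)\ge f(2)$ and $\Lambda(F)\ge1$.
        have hm3 : (m : ℝ) ≤ A * (f m - 1) * Λ F := by
          have h1 : A * (f (2 : ℕ) - 1) ≤ A * (f m - 1) := by gcongr
          have h2 : (0 : ℝ) ≤ m := Nat.cast_nonneg m
          nlinarith
        calc ∑ j, iterNorm f k (restr (E j ∩ F) x)
            ≤ ∑ j, (D * profile f (Λ (E j ∩ F)) + A * η * Λ (E j ∩ F) + η) :=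
              Finset.sum_le_sum fun j _ => hj' j
          _ = D * ∑ j, profile f (Λ (E j ∩ F)) + A * η * ∑ j, Λ (E j ∩ F) + m * η := by
              rw [Finset.sum_add_distrib, Finset.sum_add_distrib, Finset.mul_sum,
                Finset.mul_sum]
              simp
          _ ≤ D * (f m * profile f (Λ F)) + A * η * Λ F + A * (f m - 1) * Λ F * η := by
              gcongr
          _ = f m * (D * profile f (Λ F) + A * η * Λ F) := by ring

/-- A sequence of successive unit vectors, the `i`-th of which is an average of length `K i`, with
`K` growing fast. -/
structure IsRapid (f : ℝ → ℝ) (δ C : ℝ) (K s : ℕ → ℕ) (y : ℕ → ℕ →₀ ℝ) : Prop where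
  limNorm_eq : ∀ i, limNorm f (y i) = 1
  monotone_s : Monotone s
  monotone_K : Monotone K
  support_subset : ∀ i, (y i).support ⊆ Finset.Ico (s i) (s (i + 1))
  isAverage : ∀ i, IsAverage f (K i) C (y i)
  oneNorm_le : ∀ i m, K (i + 1) ≤ m → oneNorm (y i) ≤ δ * f m

/-- An average with $m\le K_i$ contributes at most $2C\le\delta f(m)$. One with $K_{i+1}\le m$
contributes at most its $\ell_1$-norm, again $\le\delta f(m)$. At most one index lies strictly in
between, and it contributes at most $f(m)$. -/
theorem IsRapid.sum_le (hf : IsAdmissible f) {δ C : ℝ} {K s : ℕ → ℕ} {y : ℕ → ℕ →₀ ℝ}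
    (hy : IsRapid f δ C K s y) (hδ : 0 ≤ δ) (hC : 0 ≤ C) (hK : 1 ≤ K 0) (l : ℕ) {m : ℕ}
    (hm : 1 ≤ m) (hfm : 2 * C ≤ δ * f m) {E : Fin m → Finset ℕ} (hE : Successive E) :
    ∑ j, limNorm f (restr (E j) (∑ i ∈ Finset.range l, y i)) ≤ f m * (1 + l * δ) := by
  have hg := isGood_limNorm hf
  have hf0 := hf.pos_nat hm
  have hi : ∀ i, ∑ j, limNorm f (restr (E j) (y i)) ≤
      f m * δ + if K i < m ∧ m < K (i + 1) then f m else 0 := fun i => by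
    have hKi : 1 ≤ K i := hK.trans (hy.monotone_K (Nat.zero_le i))
    split_ifs with h
    · have := sum_limNorm_le hf (y i) hm hE
      rw [hy.limNorm_eq, mul_one] at this
      have : 0 ≤ f m * δ := by positivity
      linarith
    · rw [not_and_or, not_lt, not_lt] at h
      rw [add_zero, mul_comm]
      rcases h with h | h
      · refine ((hy.isAverage i).sum_le hf hKi hC hE).trans (le_trans ?_ hfm)
        have : (m : ℝ) / K i ≤ 1 := by
          rw [div_le_one (by exact_mod_cast hKi)]; exact_mod_cast h
        nlinarith
      · exact (sum_limNorm_le_oneNorm hf (y i) hE).trans (hy.oneNorm_le i m h)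
  have hcard : ((Finset.range l).filter fun i => K i < m ∧ m < K (i + 1)).card ≤ 1 := by
    refine Finset.card_le_one.2 fun i hi j hj => ?_
    have hi := (Finset.mem_filter.1 hi).2
    have hj := (Finset.mem_filter.1 hj).2
    rcases lt_trichotomy i j with h | h | h
    · have := hy.monotone_K (show i + 1 ≤ j from h); omega
    · exact h
    · have := hy.monotone_K (show j + 1 ≤ i from h); omega
  calc ∑ j, limNorm f (restr (E j) (∑ i ∈ Finset.range l, y i))
      ≤ ∑ j, ∑ i ∈ Finset.range l, limNorm f (restr (E j) (y i)) :=
        Finset.sum_le_sum fun j _ => by rw [restr_sum]; exact hg.sum_le _ _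
    _ = ∑ i ∈ Finset.range l, ∑ j, limNorm f (restr (E j) (y i)) := Finset.sum_comm
    _ ≤ ∑ i ∈ Finset.range l, (f m * δ + if K i < m ∧ m < K (i + 1) then f m else 0) :=
        Finset.sum_le_sum fun i _ => hi i
    _ = l * (f m * δ) +
        ((Finset.range l).filter fun i => K i < m ∧ m < K (i + 1)).card * f m := by
        rw [Finset.sum_add_distrib, ← Finset.sum_filter]; simp
    _ ≤ l * (f m * δ) + 1 * f m := by
        have : ((((Finset.range l).filter fun i => K i < m ∧ m < K (i + 1)).card : ℕ) : ℝ) ≤ 1 := by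
          exact_mod_cast hcard
        gcongr
    _ = _ := by ring

theorem IsRapid.abs_apply_le (hf : IsAdmissible f) {δ C : ℝ} {K s : ℕ → ℕ} {y : ℕ → ℕ →₀ ℝ}
    (hy : IsRapid f δ C K s y) (l n : ℕ) : |(∑ i ∈ Finset.range l, y i) n| ≤ 1 := by
  by_cases h : ∃ i ∈ Finset.range l, y i n ≠ 0
  · obtain ⟨i, hi, hn⟩ := h
    rw [Finsupp.finsetSum_apply, Finset.sum_eq_single_of_mem i hi]
    · exact (abs_apply_le_limNorm hf _ n).trans (hy.limNorm_eq i).le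
    · intro j _ hj
      by_contra hn'
      have h1 := hy.support_subset i (Finsupp.mem_support_iff.2 hn)
      have h2 := hy.support_subset j (Finsupp.mem_support_iff.2 hn')
      rw [Finset.mem_Ico] at h1 h2
      rcases lt_or_gt_of_ne hj with h | h
      · have := hy.monotone_s (show j + 1 ≤ i from h); omega
      · have := hy.monotone_s (show i + 1 ≤ j from h); omega
  · push Not at h
    rw [Finsupp.finsetSum_apply, Finset.sum_eq_zero h]
    simp

/-- The sum of `l` terms of a rapidly increasing sequence of averages has nearly the least possible
norm `l / f l`. -/
theorem exists_limNorm_sum_le (hf : IsAdmissible f) {l : ℕ} (hl : 1 ≤ l) {ε : ℝ} (hε : 0 < ε) :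
    ∃ δ > 0, ∃ C > 1, ∃ K₀ ≥ 2, ∀ (K s : ℕ → ℕ) (y : ℕ → ℕ →₀ ℝ), IsRapid f δ C K s y →
      K₀ ≤ K 0 → limNorm f (∑ i ∈ Finset.range l, y i) ≤ (1 + ε) * (l / f l) := by
  have hl0 : (0 : ℝ) < l := by exact_mod_cast hl
  have hl1 : (1 : ℝ) ≤ l := by exact_mod_cast hl
  have hg := isGood_limNorm hf
  -- The error $\varepsilon$ is split in two: $\ell\delta=\varepsilon/2$ is the loss in
  -- $D=1+\ell\delta$, and $K_0$ will keep the additive errors $(A+1)\eta\ell$ below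
  -- $\varepsilon/2$. With $C=1+\delta$, the threshold $M$ ensures $2C\le\delta f(m)$ for $m\ge M$.
  set δ := ε / (2 * l) with hδ
  have hδ0 : 0 < δ := by positivity
  have hlδ : l * δ = ε / 2 := by rw [hδ]; field_simp
  obtain ⟨M, hM1, hM⟩ := hf.exists_nat_le (2 * (1 + δ) / δ)
  have hf2 := hf.one_lt_two
  set A := M / (f (2 : ℕ) - 1) + 1 with hA
  have hA1 : 1 ≤ A := by
    have : 0 ≤ M / (f (2 : ℕ) - 1) := div_nonneg (by positivity) (by linarith)
    linarith
  have hAM : M ≤ A * (f (2 : ℕ) - 1) := by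
    have : (M : ℝ) / (f (2 : ℕ) - 1) * (f (2 : ℕ) - 1) = M :=
      div_mul_cancel₀ _ (by linarith)
    rw [hA, add_mul, this]; linarith
  obtain ⟨K₀, hK₀⟩ := exists_nat_ge (2 * (A + 1) * (1 + δ) * l * l / ε)
  refine ⟨δ, hδ0, 1 + δ, by linarith, max K₀ 2, le_max_right _ _, fun K s y hy hK => ?_⟩
  set x := ∑ i ∈ Finset.range l, y i with hx
  have hKi : ∀ i, max K₀ 2 ≤ K i := fun i => hK.trans (hy.monotone_K (Nat.zero_le i))
  have hKpos : ∀ i, (0 : ℝ) < K i := fun i => by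
    have := (le_max_right _ _).trans (hKi i)
    exact_mod_cast (by omega : 0 < K i)
  choose q hq hqs hqn using hy.isAverage
  -- Each average has length at most 1 in this measure, shared equally among its cut points, so the
  -- total is at most $\ell$.
  set Λ : Finset ℕ → ℝ := fun E => ∑ i ∈ Finset.range l, (crossCard (q i) (K i) E : ℝ) / K i
    with hΛ
  set η := (1 + δ) * l / K 0 with hη
  have hη0 : 0 ≤ η := by have := hKpos 0; positivity
  have hηb : (A + 1) * η * l ≤ ε / 2 := by
    have h1 : (K₀ : ℝ) ≤ K 0 := by exact_mod_cast (le_max_left _ _).trans hK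
    have h2 := hK₀.trans h1
    rw [div_le_iff₀ hε] at h2
    have := hKpos 0
    have h3 : (A + 1) * η * l = (A + 1) * (1 + δ) * l * l / K 0 := by rw [hη]; ring
    rw [h3, div_le_iff₀ this]
    linarith
  have hΛ0 : ∀ E, 0 ≤ Λ E := fun E => Finset.sum_nonneg fun i _ => by have := hKpos i; positivity
  have hΛl : ∀ E, Λ E ≤ l := fun E => by
    calc Λ E ≤ ∑ i ∈ Finset.range l, (1 : ℝ) := Finset.sum_le_sum fun i _ => by
          rw [div_le_one (hKpos i)]; exact_mod_cast crossCard_le _ _ _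
      _ = l := by simp
  have hΛs : ∀ (m : ℕ) (E : Fin m → Finset ℕ) (F : Finset ℕ), Successive E → (∀ j, E j ⊆ F) →
      ∑ j, Λ (E j) ≤ Λ F := fun m E F hE hF => by
    simp only [hΛ]
    rw [Finset.sum_comm]
    refine Finset.sum_le_sum fun i _ => ?_
    rw [← Finset.sum_div]
    have := hKpos i
    gcongr
    exact_mod_cast sum_crossCard_le (q i) (K i) hE hF
  have hshort : ∀ E, limNorm f (restr E x) ≤ (1 + l * δ) * Λ E + η := fun E => by
    calc limNorm f (restr E x) ≤ ∑ i ∈ Finset.range l, limNorm f (restr E (y i)) := by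
          rw [hx, restr_sum]; exact hg.sum_le _ _
      _ ≤ ∑ i ∈ Finset.range l, ((1 + δ) * ((crossCard (q i) (K i) E : ℝ) / K i)
          + (1 + δ) / K 0) := by
          refine Finset.sum_le_sum fun i _ => ?_
          have hK0 := hKpos 0
          have hKi := hKpos i
          have hmono : (K 0 : ℝ) ≤ K i := by exact_mod_cast hy.monotone_K (Nat.zero_le i)
          refine (limNorm_restr_le_crossCard hf (hq i) (hqs i) (by positivity) (hqn i) E).trans ?_
          have : (1 + δ) / K i ≤ (1 + δ) / K 0 := by gcongr
          calc (1 + δ) / K i * ((crossCard (q i) (K i) E : ℝ) + 1)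
              = (1 + δ) * ((crossCard (q i) (K i) E : ℝ) / K i) + (1 + δ) / K i := by ring
            _ ≤ _ := by linarith
      _ = (1 + δ) * Λ E + η := by
          rw [Finset.sum_add_distrib, ← Finset.mul_sum]
          simp only [Finset.sum_const, Finset.card_range, nsmul_eq_mul, hη, hΛ]
          ring
      _ ≤ (1 + l * δ) * Λ E + η := by
          have := hΛ0 E
          have : δ ≤ l * δ := by nlinarith
          gcongr
  have hlong : ∀ m : ℕ, M ≤ m → 1 ≤ m → ∀ E : Fin m → Finset ℕ, Successive E →
      ∑ j, limNorm f (restr (E j) x) ≤ f m * (1 + l * δ) := fun m hMm hm E hE => by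
    refine hy.sum_le hf hδ0.le (by linarith) ?_ l hm ?_ hE
    · have := (le_max_right _ _).trans hK; omega
    · have := hM m hMm
      rw [div_le_iff₀ hδ0] at this
      linarith
  -- The additive $\varepsilon/2$ becomes a relative error because $\ell/f(\ell)\ge1$.
  have hbound : (1 + l * δ) * (l / f l) + (A + 1) * η * l ≤ (1 + ε) * (l / f l) := by
    have := hf.one_le_div hl1
    rw [hlδ]
    nlinarith
  refine le_trans ?_ hbound
  have hxs : restr x.support x = x := restr_eq_self le_rfl
  have hη1 : η * Λ x.support ≤ η * l := mul_le_mul_of_nonneg_left (hΛl _) hη0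
  have hAη : 0 ≤ A * η := mul_nonneg (by linarith) hη0
  have hηl : η ≤ η * l := by nlinarith
  have hAl : 0 ≤ A * η * l := by positivity
  rcases le_total 1 (Λ x.support) with h | h
  · refine ciSup_le fun k => ?_
    have h1 := iterNorm_le_of_length hf hΛ0 hΛs (hy.abs_apply_le hf l) (by nlinarith) hη0 hA1 hAM
      hshort hlong k _ h
    rw [hxs] at h1
    refine h1.trans ?_
    have h2 := hf.profile_monotone (hΛl x.support)
    rw [hf.profile_of_one_le hl1] at h2
    have h3 : A * η * Λ x.support ≤ A * η * l := mul_le_mul_of_nonneg_left (hΛl _) hAη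
    have h4 : (1 + l * δ) * profile f (Λ x.support) ≤ (1 + l * δ) * (l / f l) :=
      mul_le_mul_of_nonneg_left h2 (by positivity)
    have : 0 ≤ η * l := by positivity
    linarith
  · have h1 := hshort x.support
    rw [hxs] at h1
    have h2 : (1 + l * δ) * Λ x.support ≤ (1 + l * δ) * (l / f l) :=
      mul_le_mul_of_nonneg_left (h.trans (hf.one_le_div hl1)) (by positivity)
    linarith

end RapidlyIncreasing

/-! ### The completion and the norms $\|\cdot\|_\ell$. -/

section Space

variable {f : ℝ → ℝ}

/-- The canonical map from `c₀₀` to `X`. -/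
noncomputable def XSpace.ofFinsupp (hf : IsAdmissible f) : (ℕ →₀ ℝ) →ₗ[ℝ] XSpace f hf where
  toFun u := ((show C00 f hf from u : C00 f hf) : XSpace f hf)
  map_add' u v := UniformSpace.Completion.coe_add (show C00 f hf from u) (show C00 f hf from v)
  map_smul' a u := UniformSpace.Completion.coe_smul a (show C00 f hf from u)

namespace XSpace

theorem norm_ofFinsupp (hf : IsAdmissible f) (u : ℕ →₀ ℝ) : ‖ofFinsupp hf u‖ = limNorm f u :=
  UniformSpace.Completion.norm_coe (show C00 f hf from u)

theorem restrL_ofFinsupp (hf : IsAdmissible f) (E : Finset ℕ) (u : ℕ →₀ ℝ) :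
    restrL E (ofFinsupp hf u) = ofFinsupp hf (restr E u) :=
  UniformSpace.Completion.map_coe (C00.restrL f hf E).uniformContinuous (show C00 f hf from u)

theorem induction_ofFinsupp (hf : IsAdmissible f) {p : XSpace f hf → Prop} (x : XSpace f hf)
    (hp : IsClosed {x | p x}) (h : ∀ u, p (ofFinsupp hf u)) : p x :=
  UniformSpace.Completion.induction_on x hp fun u => h u

theorem exists_norm_sub_lt (hf : IsAdmissible f) (x : XSpace f hf) {ε : ℝ} (hε : 0 < ε) :
    ∃ u, ‖x - ofFinsupp hf u‖ < ε := by
  obtain ⟨u, hu⟩ := UniformSpace.Completion.denseRange_coe.exists_dist_lt x hε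
  exact ⟨u, by rwa [dist_eq_norm] at hu⟩

variable {hf : IsAdmissible f}

theorem norm_restrL_le (E : Finset ℕ) (x : XSpace f hf) : ‖restrL E x‖ ≤ ‖x‖ := by
  refine induction_ofFinsupp hf (p := fun x => ‖restrL E x‖ ≤ ‖x‖) x
    (isClosed_le (by fun_prop) (by fun_prop)) fun u => ?_
  rw [restrL_ofFinsupp, norm_ofFinsupp, norm_ofFinsupp]
  exact (isGood_limNorm hf).restr_le E u

theorem sum_norm_restrL_le {m : ℕ} (hm : 1 ≤ m) {E : Fin m → Finset ℕ} (hE : Successive E)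
    (x : XSpace f hf) : ∑ j, ‖restrL (E j) x‖ ≤ f m * ‖x‖ := by
  refine induction_ofFinsupp hf (p := fun x => ∑ j, ‖restrL (E j) x‖ ≤ f m * ‖x‖) x
    (isClosed_le (by fun_prop) (by fun_prop)) fun u => ?_
  simp only [restrL_ofFinsupp, norm_ofFinsupp]
  exact sum_limNorm_le hf u hm hE

variable {l : ℕ}

theorem le_lNorm (hl : 1 ≤ l) (x : XSpace f hf) {E : Fin l → Finset ℕ} (hE : Successive E) :
    1 / f l * ∑ i, ‖restrL (E i) x‖ ≤ lNorm l x := by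
  refine le_csSup ⟨‖x‖, ?_⟩ ⟨E, hE, rfl⟩
  rintro _ ⟨E, hE, rfl⟩
  rw [one_div, inv_mul_le_iff₀ (hf.pos_nat hl)]
  exact sum_norm_restrL_le hl hE x

theorem lNorm_le (x : XSpace f hf) {B : ℝ} (h : ∀ E : Fin l → Finset ℕ, Successive E →
    1 / f l * ∑ i, ‖restrL (E i) x‖ ≤ B) : lNorm l x ≤ B := by
  refine csSup_le ⟨_, fun _ => ∅, fun i j _ a ha => absurd ha (Finset.notMem_empty a), rfl⟩ ?_
  rintro _ ⟨E, hE, rfl⟩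
  exact h E hE

theorem lNorm_le_norm (hl : 1 ≤ l) (x : XSpace f hf) : lNorm l x ≤ ‖x‖ :=
  lNorm_le x fun E hE => by
    rw [one_div, inv_mul_le_iff₀ (hf.pos_nat hl)]
    exact sum_norm_restrL_le hl hE x

theorem lNorm_nonneg (hl : 1 ≤ l) (x : XSpace f hf) : 0 ≤ lNorm l x := by
  have h := le_lNorm hl x (E := fun _ => ∅) fun i j _ a ha => absurd ha (Finset.notMem_empty a)
  have := hf.pos_nat hl
  exact le_trans (by positivity) h

theorem lNorm_add_le (hl : 1 ≤ l) (x y : XSpace f hf) :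
    lNorm l (x + y) ≤ lNorm l x + lNorm l y := by
  refine lNorm_le _ fun E hE => le_trans ?_ (add_le_add (le_lNorm hl x hE) (le_lNorm hl y hE))
  have := hf.pos_nat hl
  rw [← mul_add, ← Finset.sum_add_distrib]
  refine mul_le_mul_of_nonneg_left (Finset.sum_le_sum fun i _ => ?_) (by positivity)
  rw [map_add]
  exact norm_add_le _ _

theorem lNorm_smul (hl : 1 ≤ l) (a : ℝ) (x : XSpace f hf) :
    lNorm l (a • x) = |a| * lNorm l x := by
  have key : ∀ (a : ℝ) (x : XSpace f hf), lNorm l (a • x) ≤ |a| * lNorm l x := fun a x => by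
    refine lNorm_le _ fun E hE => le_trans (le_of_eq ?_)
      (mul_le_mul_of_nonneg_left (le_lNorm hl x hE) (abs_nonneg a))
    simp only [map_smul, norm_smul, Real.norm_eq_abs, ← Finset.mul_sum]
    ring
  refine le_antisymm (key a x) ?_
  rcases eq_or_ne a 0 with rfl | ha
  · simpa using lNorm_nonneg hl _
  · have := key a⁻¹ (a • x)
    rwa [inv_smul_smul₀ ha, abs_inv, ← div_eq_inv_mul, le_div_iff₀' (abs_pos.2 ha)] at this

theorem lNorm_le_add_norm_sub (hl : 1 ≤ l) (x y : XSpace f hf) :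
    lNorm l x ≤ lNorm l y + ‖x - y‖ := by
  have := lNorm_add_le hl y (x - y)
  rw [add_sub_cancel] at this
  linarith [lNorm_le_norm hl (x - y)]

theorem norm_restrL_le_lNorm (hl : 1 ≤ l) (E : Finset ℕ) (x : XSpace f hf) :
    1 / f l * ‖restrL E x‖ ≤ lNorm l x := by
  set i₀ : Fin l := ⟨0, hl⟩
  have hE : Successive fun i : Fin l => if i = i₀ then E else ∅ := fun i j hij a ha b hb => by
    have hj : j ≠ i₀ := by
      rintro rfl
      exact absurd hij (by simp [i₀, Fin.lt_def])
    simp [hj] at hb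
  refine le_trans ?_ (le_lNorm hl x hE)
  have := hf.pos_nat hl
  refine mul_le_mul_of_nonneg_left ?_ (by positivity)
  have h := Finset.single_le_sum (f := fun i => ‖restrL (if i = i₀ then E else ∅) x‖)
    (fun i _ => norm_nonneg _) (Finset.mem_univ i₀)
  simpa using h

/-- A single set already gives this lower bound: restricting $x$ to the support of a close finitely
supported vector loses little norm. -/
theorem norm_le_lNorm (hl : 1 ≤ l) (x : XSpace f hf) : 1 / f l * ‖x‖ ≤ lNorm l x := by
  have h0 : 0 < 1 / f l := by have := hf.pos_nat hl; positivity
  refine le_of_forall_pos_le_add fun ε hε => ?_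
  have hδ : 0 < ε / (2 * (1 / f l)) := by positivity
  obtain ⟨u, hu⟩ := exists_norm_sub_lt hf x hδ
  have h1 := norm_restrL_le_lNorm hl u.support x
  have h2 : ‖x‖ ≤ ‖restrL u.support x‖ + 2 * (ε / (2 * (1 / f l))) := by
    have h3 : x = restrL u.support x + (x - ofFinsupp hf u)
        - restrL u.support (x - ofFinsupp hf u) := by
      rw [map_sub, restrL_ofFinsupp, restr_eq_self le_rfl]
      abel
    have h4 := norm_restrL_le u.support (x - ofFinsupp hf u)
    calc ‖x‖ = ‖restrL u.support x + (x - ofFinsupp hf u)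
        - restrL u.support (x - ofFinsupp hf u)‖ := by rw [← h3]
      _ ≤ ‖restrL u.support x‖ + ‖x - ofFinsupp hf u‖
        + ‖restrL u.support (x - ofFinsupp hf u)‖ :=
        (norm_sub_le _ _).trans (by gcongr; exact norm_add_le _ _)
      _ ≤ _ := by linarith
  have h5 := mul_le_mul_of_nonneg_left h2 h0.le
  have h6 : 1 / f l * (‖restrL u.support x‖ + 2 * (ε / (2 * (1 / f l)))) =
      1 / f l * ‖restrL u.support x‖ + ε := by
    rw [mul_add, add_right_inj, mul_div_assoc', mul_div_mul_left _ _ two_ne_zero,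
      mul_div_cancel₀ _ h0.ne']
  linarith

theorem lNorm_ofFinsupp_le (hl : 1 ≤ l) {u : ℕ →₀ ℝ} {B : ℝ}
    (h : ∀ E : Fin l → Finset ℕ, Successive E → ∑ i, limNorm f (restr (E i) u) ≤ B) :
    lNorm l (ofFinsupp hf u) ≤ B / f l := by
  refine lNorm_le _ fun E hE => ?_
  simp only [restrL_ofFinsupp, norm_ofFinsupp]
  rw [div_mul_eq_mul_div, one_mul]
  have := hf.pos_nat hl
  gcongr
  exact h E hE

theorem not_finiteDimensional (hf : IsAdmissible f) : ¬ FiniteDimensional ℝ (XSpace f hf) := by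
  intro h
  have hinj : Function.Injective (ofFinsupp hf) := by
    refine (injective_iff_map_eq_zero _).2 fun u hu => ?_
    rw [← limNorm_eq_zero hf, ← norm_ofFinsupp hf, hu, norm_zero]
  have h1 := FiniteDimensional.of_injective _ hinj
  have := (Finsupp.basisSingleOne (R := ℝ) (ι := ℕ)).linearIndependent.finite
  exact not_finite ℕ

/-! ### Finitely supported vectors close to a subspace. -/

/-- An infinite dimensional subspace contains vectors vanishing on any given finite set. -/
theorem exists_restrL_eq_zero {Z : Submodule ℝ (XSpace f hf)} (hZ : ¬ FiniteDimensional ℝ Z)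
    (E : Finset ℕ) : ∃ z ∈ Z, z ≠ 0 ∧ restrL E z = 0 := by
  by_contra! hcon
  let F : Submodule ℝ (XSpace f hf) :=
    Submodule.span ℝ ((fun k => ofFinsupp hf (Finsupp.single k 1)) '' (E : Set ℕ))
  have hFD : FiniteDimensional ℝ F := FiniteDimensional.span_of_finite ℝ (E.finite_toSet.image _)
  have hF : ∀ x, restrL E x ∈ F := fun x => by
    refine induction_ofFinsupp hf (p := fun x => restrL E x ∈ F) x
      (F.closed_of_finiteDimensional.preimage (restrL E).continuous) fun u => ?_
    have h1 : restr E u = ∑ k ∈ E, u k • Finsupp.single k 1 := by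
      ext n
      rw [restr_apply, Finsupp.finsetSum_apply]
      simp [Finsupp.single_apply]
    rw [restrL_ofFinsupp, h1, map_sum]
    refine F.sum_mem fun k hk => ?_
    rw [map_smul]
    exact F.smul_mem _ (Submodule.subset_span (Set.mem_image_of_mem _ hk))
  -- If no nonzero vector of $Z$ were killed, this map would embed $Z$ in a finite dimensional
  -- space.
  let φ : Z →ₗ[ℝ] F := ((restrL E).toLinearMap.comp Z.subtype).codRestrict F fun z => hF z
  refine hZ (FiniteDimensional.of_injective φ ((injective_iff_map_eq_zero _).2 fun z hz => ?_))
  by_contra hne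
  exact hcon z z.2 (by simpa using hne) (congrArg Subtype.val hz)

/-- `u` is at distance at most `ε` from some element of `Z`. -/
def Near (Z : Submodule ℝ (XSpace f hf)) (ε : ℝ) (u : ℕ →₀ ℝ) : Prop :=
  ∃ z ∈ Z, ‖z - ofFinsupp hf u‖ ≤ ε

variable {Z : Submodule ℝ (XSpace f hf)}

theorem Near.smul {ε : ℝ} {u : ℕ →₀ ℝ} (h : Near Z ε u) {a : ℝ} (ha : |a| ≤ 1) :
    Near Z ε (a • u) := by
  obtain ⟨z, hz, hzu⟩ := h
  refine ⟨a • z, Z.smul_mem a hz, ?_⟩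
  rw [map_smul, ← smul_sub, norm_smul, Real.norm_eq_abs]
  exact (mul_le_of_le_one_left (norm_nonneg _) ha).trans hzu

theorem Near.sum {ι : Type*} {s : Finset ι} {ε : ℝ} {u : ι → ℕ →₀ ℝ}
    (h : ∀ i ∈ s, Near Z ε (u i)) : Near Z (s.card * ε) (∑ i ∈ s, u i) := by
  choose! z hz hzu using h
  refine ⟨∑ i ∈ s, z i, Z.sum_mem hz, ?_⟩
  rw [map_sum, ← Finset.sum_sub_distrib, ← nsmul_eq_mul]
  exact (norm_sum_le _ _).trans (Finset.sum_le_card_nsmul _ _ _ hzu)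

theorem Near.mono {ε ε' : ℝ} {u : ℕ →₀ ℝ} (h : Near Z ε u) (hε : ε ≤ ε') : Near Z ε' u := by
  obtain ⟨z, hz, hzu⟩ := h
  exact ⟨z, hz, hzu.trans hε⟩

theorem exists_near_unit (hZ : ¬ FiniteDimensional ℝ Z) (n : ℕ) {ε : ℝ} (hε : 0 < ε) :
    ∃ u, limNorm f u = 1 ∧ (∀ k ∈ u.support, n ≤ k) ∧ Near Z ε u := by
  have hg := isGood_limNorm hf
  obtain ⟨z₀, hz₀, hne, hres₀⟩ := exists_restrL_eq_zero hZ (Finset.range n)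
  obtain ⟨z, hz, hz1, hres⟩ : ∃ z ∈ Z, ‖z‖ = 1 ∧ restrL (Finset.range n) z = 0 :=
    ⟨‖z₀‖⁻¹ • z₀, Z.smul_mem _ hz₀, norm_smul_inv_norm hne, by rw [map_smul, hres₀, smul_zero]⟩
  -- Deleting the first $n$ coordinates doubles the error, and normalizing a vector of norm at least
  -- $1/2$ doubles it again.
  set ε' := min (ε / 4) (1 / 4) with hε'
  have hε'0 : 0 < ε' := lt_min (by positivity) (by norm_num)
  obtain ⟨u₀, hu₀⟩ := exists_norm_sub_lt hf z hε'0
  set u₁ := u₀ - restr (Finset.range n) u₀ with hu₁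
  have hd : ‖z - ofFinsupp hf u₁‖ ≤ 2 * ε' := by
    have h1 : z - ofFinsupp hf u₁ = (z - ofFinsupp hf u₀)
        - restrL (Finset.range n) (z - ofFinsupp hf u₀) := by
      rw [hu₁, map_sub, map_sub, hres, restrL_ofFinsupp]
      abel
    have h2 := norm_restrL_le (Finset.range n) (z - ofFinsupp hf u₀)
    have h3 := norm_sub_le (z - ofFinsupp hf u₀)
      (restrL (Finset.range n) (z - ofFinsupp hf u₀))
    rw [h1]
    linarith
  have hN : 1 / 2 ≤ limNorm f u₁ := by
    have h1 := norm_sub_norm_le z (ofFinsupp hf u₁)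
    rw [hz1, norm_ofFinsupp] at h1
    have := min_le_right (ε / 4) (1 / 4)
    linarith
  have hN0 : 0 < limNorm f u₁ := by linarith
  refine ⟨(limNorm f u₁)⁻¹ • u₁, ?_, fun k hk => ?_, (limNorm f u₁)⁻¹ • z, Z.smul_mem _ hz, ?_⟩
  · rw [hg.smul_eq, abs_inv, abs_of_pos hN0, inv_mul_cancel₀ hN0.ne']
  · by_contra! hkn
    have hk := Finsupp.mem_support_iff.1 (Finsupp.support_smul hk)
    exact hk (by rw [hu₁, Finsupp.sub_apply, restr_apply, if_pos (Finset.mem_range.2 hkn),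
      sub_self])
  · rw [map_smul, ← smul_sub, norm_smul, Real.norm_eq_abs, abs_inv, abs_of_pos hN0,
      inv_mul_le_iff₀ hN0]
    have := min_le_left (ε / 4) (1 / 4)
    nlinarith

/-- A common bound for the support of `u` and for `n`. -/
def supportBound (n : ℕ) (u : ℕ →₀ ℝ) : ℕ := max n (u.support.sup id + 1)

theorem support_subset_Ico {n : ℕ} {u : ℕ →₀ ℝ} (h : ∀ k ∈ u.support, n ≤ k) :
    u.support ⊆ Finset.Ico n (supportBound n u) := fun k hk => by
  have h1 : k ≤ u.support.sup id := Finset.le_sup (f := id) hk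
  exact Finset.mem_Ico.2 ⟨h k hk, lt_max_of_lt_right (Nat.lt_succ_of_le h1)⟩

theorem exists_near_isAverage (hZ : ¬ FiniteDimensional ℝ Z) {N : ℕ} (hN : 2 ≤ N) {C : ℝ}
    (hC : 1 < C) (n : ℕ) {ε : ℝ} (hε : 0 < ε) :
    ∃ y, limNorm f y = 1 ∧ (∀ k ∈ y.support, n ≤ k) ∧ IsAverage f N C y ∧ Near Z ε y := by
  have hg := isGood_limNorm hf
  obtain ⟨k, hk⟩ := hf.exists_pow_lt hN hC
  have hNk : (0 : ℝ) < (N ^ k : ℕ) := by exact_mod_cast pow_pos (by omega : 0 < N) k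
  choose U hU1 hUs hUn using fun n => exists_near_unit hZ n (div_pos hε hNk)
  -- Greedy choice: each vector starts beyond the support of its predecessor.
  set s : ℕ → ℕ := fun j => Nat.rec n (fun _ m => supportBound m (U m)) j with hsdef
  have hs : Monotone s := monotone_nat_of_le_succ fun j => le_max_left _ _
  have hu : ∀ j, (U (s j)).support ⊆ Finset.Ico (s j) (s (j + 1)) := fun j =>
    support_subset_Ico (hUs (s j))
  obtain ⟨a, b, hab, hb, hav⟩ := exists_isAverage hf hN hC hk hs hu fun j => hU1 (s j)
  set v := ∑ j ∈ Finset.Ico a b, U (s j) with hv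
  -- The sum dominates its first block, so normalizing it does not increase the distance to $Z$.
  have hv1 : 1 ≤ limNorm f v := by
    rw [← hU1 (s a)]
    exact limNorm_le_sum_blocks hf hs hu le_rfl hab
  have hv0 : 0 < limNorm f v := by linarith
  refine ⟨_, ?_, fun i hi => ?_, hav, ?_⟩
  · rw [hg.smul_eq, abs_inv, abs_of_pos hv0, inv_mul_cancel₀ hv0.ne']
  · have h1 := support_sum_blocks hs hu a b (Finsupp.support_smul hi)
    exact (hs (Nat.zero_le a)).trans (Finset.mem_Ico.1 h1).1
  · refine Near.smul ?_ (by rw [abs_inv, abs_of_pos hv0]; exact inv_le_one_of_one_le₀ hv1)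
    refine (Near.sum fun j _ => hUn (s j)).mono ?_
    have h1 : ((Finset.Ico a b).card : ℝ) ≤ (N ^ k : ℕ) := by
      rw [Nat.card_Ico]; exact_mod_cast (Nat.sub_le b a).trans hb
    rw [mul_div_assoc', div_le_iff₀ hNk, mul_comm]
    gcongr

theorem exists_near_isRapid (hZ : ¬ FiniteDimensional ℝ Z) {δ C : ℝ} (hδ : 0 < δ) (hC : 1 < C)
    {K₀ : ℕ} (hK₀ : 2 ≤ K₀) {ε : ℝ} (hε : 0 < ε) :
    ∃ (K s : ℕ → ℕ) (y : ℕ → ℕ →₀ ℝ), IsRapid f δ C K s y ∧ K₀ ≤ K 0 ∧ ∀ i, Near Z ε (y i) := by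
  have hY : ∀ p : ℕ × ℕ, ∃ y, limNorm f y = 1 ∧ (∀ k ∈ y.support, p.1 ≤ k) ∧
      IsAverage f (max K₀ p.2) C y ∧ Near Z ε y := fun p =>
    exists_near_isAverage hZ (hK₀.trans (le_max_left _ _)) hC p.1 hε
  choose Y hY1 hYs hYa hYn using hY
  have hT : ∀ y : ℕ →₀ ℝ, ∃ T : ℕ, ∀ m ≥ T, oneNorm y ≤ δ * f m := fun y => by
    obtain ⟨T, _, hT⟩ := hf.exists_nat_le (oneNorm y / δ)
    exact ⟨T, fun m hm => by have := hT m hm; rwa [div_le_iff₀' hδ] at this⟩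
  choose T hT using hT
  -- The recursion carries the starting point of the next support and the next average length, the
  -- latter chosen beyond the threshold `T` of the vector just built.
  set t : ℕ → ℕ × ℕ := fun j => Nat.rec (0, K₀)
    (fun _ p => (supportBound p.1 (Y p), max p.2 (T (Y p)))) j with ht
  have hK : Monotone fun i => (t i).2 := monotone_nat_of_le_succ fun j => le_max_left _ _
  refine ⟨fun i => (t i).2, fun i => (t i).1, fun i => Y (t i), ⟨fun i => hY1 _,
    monotone_nat_of_le_succ fun j => le_max_left _ _, hK, fun i => support_subset_Ico (hYs (t i)),
    fun i => ?_, fun i m hm => hT _ m ((le_max_right _ _).trans hm)⟩, le_rfl, fun i => hYn _⟩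
  have h1 : max K₀ (t i).2 = (t i).2 := max_eq_right (hK (Nat.zero_le i))
  have h2 := hYa (t i)
  rwa [h1] at h2

/-! ### The two extremal vectors and the distortion. -/

theorem exists_le_lNorm (hl : 1 ≤ l) {ε : ℝ} (hε : 0 < ε) (hZ : ¬ FiniteDimensional ℝ Z) :
    ∃ z ∈ Z, ‖z‖ = 1 ∧ 1 - ε ≤ lNorm l z := by
  have hl0 : (0 : ℝ) < l := by exact_mod_cast hl
  set ε' := min (ε / 3) (1 / 3) with hε'
  have hε'0 : 0 < ε' := lt_min (by positivity) (by norm_num)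
  have hε'3 : 3 * ε' ≤ ε := by linarith [min_le_left (ε / 3) (1 / 3)]
  have hε'1 : ε' ≤ 1 / 3 := min_le_right _ _
  obtain ⟨δ, hδ, C, hC, K₀, hK₀, hmain⟩ := exists_limNorm_sum_le hf hl hε'0
  obtain ⟨K, s, y, hy, hK, hn⟩ := exists_near_isRapid hZ hδ hC hK₀ (div_pos hε'0 hl0)
  have hup := hmain K s y hy hK
  rw [Finset.range_eq_Ico] at hup
  set x := ∑ i ∈ Finset.Ico 0 l, y i with hx
  obtain ⟨z, hz, hzx⟩ : Near Z ε' x := by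
    refine (Near.sum fun i _ => hn i).mono (le_of_eq ?_)
    rw [Nat.card_Ico, Nat.sub_zero, mul_div_cancel₀ _ hl0.ne']
  set g := (l : ℝ) / f l with hgdef
  have hg1 : 1 ≤ g := hf.one_le_div (by exact_mod_cast hl)
  have hlow : g ≤ lNorm l (ofFinsupp hf x) := by
    obtain ⟨E, hE, hEy⟩ := exists_successive_blocks hy.monotone_s hy.support_subset l
    refine le_trans (le_of_eq ?_) (le_lNorm hl (ofFinsupp hf x) hE)
    simp only [restrL_ofFinsupp, norm_ofFinsupp, hx, hEy, hy.limNorm_eq, Finset.sum_const,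
      Finset.card_univ, Fintype.card_fin, nsmul_eq_mul, mul_one]
    rw [hgdef]; ring
  have hlow' : g - ε' ≤ lNorm l z := by
    have := lNorm_le_add_norm_sub hl (ofFinsupp hf x) z
    rw [norm_sub_rev] at this
    linarith
  have hup' : ‖z‖ ≤ (1 + ε') * g + ε' := by
    have := norm_sub_norm_le z (ofFinsupp hf x)
    rw [norm_ofFinsupp] at this
    linarith
  have hz0 : 0 < ‖z‖ := by
    have := lNorm_le_norm hl z
    linarith
  refine ⟨‖z‖⁻¹ • z, Z.smul_mem _ hz, norm_smul_inv_norm (norm_pos_iff.1 hz0), ?_⟩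
  rw [lNorm_smul hl, abs_inv, abs_of_pos hz0, inv_mul_eq_div, le_div_iff₀ hz0]
  have h1 : (1 - ε) * ‖z‖ ≤ (1 - 3 * ε') * ‖z‖ := by gcongr
  have h2 : (1 - 3 * ε') * ‖z‖ ≤ (1 - 3 * ε') * ((1 + ε') * g + ε') :=
    mul_le_mul_of_nonneg_left hup' (by linarith)
  -- Three errors of size $\varepsilon'$ suffice because $g\ge1$: the difference of the sides is
  -- $2\varepsilon'(g-1)+3\varepsilon'^2(g+1)$.
  have h3 : (1 - 3 * ε') * ((1 + ε') * g + ε') ≤ g - ε' := by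
    nlinarith [mul_nonneg hε'0.le (sub_nonneg.2 hg1), mul_pos hε'0 hε'0,
      mul_nonneg (mul_pos hε'0 hε'0).le (sub_nonneg.2 hg1)]
  linarith

theorem exists_lNorm_le (hl : 1 ≤ l) {ε : ℝ} (hε : 0 < ε) (hZ : ¬ FiniteDimensional ℝ Z) :
    ∃ z ∈ Z, ‖z‖ = 1 ∧ lNorm l z ≤ (1 + ε) / f l := by
  have hfl := hf.pos_nat hl
  have hfl1 := hf.one_le hl
  set δ := min (ε / 10) (1 / 10) with hδ
  have hδ0 : 0 < δ := lt_min (by positivity) (by norm_num)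
  have hδε : 10 * δ ≤ ε := by linarith [min_le_left (ε / 10) (1 / 10)]
  have hδ1 : δ ≤ 1 / 10 := min_le_right _ _
  obtain ⟨N₀, hN₀⟩ := exists_nat_ge (l / δ)
  set N := max N₀ 2 with hN
  have hN2 : 2 ≤ N := le_max_right _ _
  have hN0 : (0 : ℝ) < N := by exact_mod_cast (by omega : 0 < N)
  have hlN : (l : ℝ) / N ≤ δ := by
    have h1 : (N₀ : ℝ) ≤ N := by exact_mod_cast le_max_left _ _
    have h2 := hN₀.trans h1
    rw [div_le_iff₀ hδ0] at h2
    rw [div_le_iff₀ hN0]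
    linarith
  -- The distance to $Z$ is taken relative to $1/f(\ell)$, the size of the quantity to be bounded.
  obtain ⟨y, hy1, -, hya, z, hz, hzy⟩ := exists_near_isAverage hZ hN2
    (by linarith : 1 < 1 + δ) 0 (div_pos hδ0 hfl)
  have hδf : δ / f l ≤ δ := div_le_self hδ0.le hfl1
  have hup : lNorm l z ≤ (1 + δ) * (1 + δ) / f l + δ / f l := by
    refine (lNorm_le_add_norm_sub hl z (ofFinsupp hf y)).trans (add_le_add ?_ hzy)
    refine lNorm_ofFinsupp_le hl fun E hE => ?_
    refine (hya.sum_le hf (by omega) (by linarith) hE).trans ?_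
    gcongr
  have hlow : 1 - δ ≤ ‖z‖ := by
    have := norm_sub_norm_le (ofFinsupp hf y) z
    rw [norm_ofFinsupp, hy1, norm_sub_rev] at this
    linarith
  have hz0 : 0 < ‖z‖ := by linarith
  refine ⟨‖z‖⁻¹ • z, Z.smul_mem _ hz, norm_smul_inv_norm (norm_pos_iff.1 hz0), ?_⟩
  rw [lNorm_smul hl, abs_inv, abs_of_pos hz0, inv_mul_le_iff₀ hz0]
  refine hup.trans ?_
  rw [← add_div, mul_div_assoc']
  gcongr
  -- For $\delta\le1/10$ the left side exceeds $(1+\delta)^2+\delta$, the numerator of the upper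
  -- bound.
  have h1 : (1 - δ) * (1 + 10 * δ) ≤ ‖z‖ * (1 + ε) := by gcongr
  nlinarith

theorem isDistortion_lNorm (hf : IsAdmissible f) (hl : 2 ≤ l) :
    IsDistortion (f l) (fun x : XSpace f hf => lNorm l x) where
  infinite_dimensional := not_finiteDimensional hf
  one_lt := hf.one_lt_two.trans_le (hf.monotone_nat (by norm_num) hl)
  add_le := lNorm_add_le (by omega)
  smul_eq := lNorm_smul (by omega)
  equivalent := by
    have := hf.pos_nat (by omega : 1 ≤ l)
    refine ⟨1 / f l, 1, by positivity, one_pos, fun x => ⟨norm_le_lNorm (by omega) x, ?_⟩⟩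
    rw [one_mul]
    exact lNorm_le_norm (by omega) x
  le_sup Y hY := by
    have hl1 : 1 ≤ l := by omega
    have hfl := hf.pos_nat hl1
    -- Boundedness makes `sSup` the true supremum; $1/f(\ell)\le\|y\|_\ell\le1$ on unit vectors
    -- bounds every ratio by $f(\ell)$.
    have hbdd : BddAbove {r : ℝ | ∃ y₁ ∈ Y, ∃ y₂ ∈ Y, ‖y₁‖ = 1 ∧ ‖y₂‖ = 1 ∧
        r = lNorm l y₁ / lNorm l y₂} := by
      refine ⟨f l, ?_⟩
      rintro _ ⟨y₁, _, y₂, _, h1, h2, rfl⟩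
      have h3 := lNorm_le_norm hl1 y₁
      have h4 := norm_le_lNorm hl1 y₂
      rw [h1] at h3
      rw [h2, mul_one, div_le_iff₀ hfl] at h4
      have h5 : 0 < lNorm l y₂ := pos_of_mul_pos_left (by linarith) hfl.le
      rw [div_le_iff₀ h5]
      linarith
    have key : ∀ ε : ℝ, 0 < ε → ε < 1 → (1 - ε) / (1 + ε) * f l ≤
        sSup {r : ℝ | ∃ y₁ ∈ Y, ∃ y₂ ∈ Y, ‖y₁‖ = 1 ∧ ‖y₂‖ = 1 ∧
          r = lNorm l y₁ / lNorm l y₂} := fun ε hε hε1 => by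
      obtain ⟨z₁, hz₁, h1, h1'⟩ := exists_le_lNorm hl1 hε hY
      obtain ⟨z₂, hz₂, h2, h2'⟩ := exists_lNorm_le hl1 hε hY
      refine le_trans ?_ (le_csSup hbdd ⟨z₁, hz₁, z₂, hz₂, h1, h2, rfl⟩)
      have h4 := norm_le_lNorm hl1 z₂
      rw [h2, mul_one] at h4
      have h5 : 0 < lNorm l z₂ := lt_of_lt_of_le (by positivity) h4
      calc (1 - ε) / (1 + ε) * f l = (1 - ε) / ((1 + ε) / f l) := by
            field_simp
        _ ≤ lNorm l z₁ / lNorm l z₂ :=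
          div_le_div₀ (by linarith) h1' h5 h2'
    -- The extremal vectors depend on $\varepsilon$, so the ratio $f(\ell)$ is reached only in the
    -- limit $\varepsilon\to0^+$.
    have hlim : Filter.Tendsto (fun ε : ℝ => (1 - ε) / (1 + ε) * f l) (nhdsWithin 0 (Set.Ioi 0))
        (nhds (f l)) := by
      have hc : ContinuousAt (fun ε : ℝ => (1 - ε) / (1 + ε) * f l) 0 := by
        refine ContinuousAt.mul (ContinuousAt.div ?_ ?_ (by norm_num)) continuousAt_const <;>
          fun_prop
      have := hc.tendsto
      simp only [sub_zero, add_zero, div_one, one_mul] at this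
      exact this.mono_left nhdsWithin_le_nhds
    refine le_of_tendsto hlim ?_
    filter_upwards [Ioo_mem_nhdsGT (show (0 : ℝ) < 1 from one_pos)] with ε hε
    exact key ε hε.1 hε.2

theorem arbitrarilyDistortable (hf : IsAdmissible f) : ArbitrarilyDistortable (XSpace f hf) := by
  intro lam hlam
  obtain ⟨M, _, hM⟩ := hf.exists_nat_le lam
  have h := isDistortion_lNorm hf (le_max_right M 2)
  exact ⟨_, { h with
    one_lt := hlam
    le_sup := fun Y hY => (hM _ (le_max_left M 2)).trans (h.le_sup Y hY) }⟩

end XSpace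

end Space

theorem theorem3 :
    IsAdmissible (fun x : ℝ => Real.logb 2 (x + 1)) ∧
    ∀ (f : ℝ → ℝ) (hf : IsAdmissible f),
      (∀ l : ℕ, 1 ≤ l → ∀ ε : ℝ, 0 < ε →
        ∀ Z : Submodule ℝ (XSpace f hf), ¬ FiniteDimensional ℝ Z →
          ∃ z₁ ∈ Z, ∃ z₂ ∈ Z, ‖z₁‖ = 1 ∧ ‖z₂‖ = 1 ∧
            1 - ε ≤ XSpace.lNorm l z₁ ∧ XSpace.lNorm l z₂ ≤ (1 + ε) / f l) ∧
      (∀ l : ℕ, 2 ≤ l →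
        IsDistortion (f l) (fun x : XSpace f hf => XSpace.lNorm l x)) ∧
      ArbitrarilyDistortable (XSpace f hf) := by
  refine ⟨isAdmissible_logb, fun f hf => ⟨fun l hl ε hε Z hZ => ?_,
    fun l hl => XSpace.isDistortion_lNorm hf hl, XSpace.arbitrarilyDistortable hf⟩⟩
  obtain ⟨z₁, hz₁, h1, h1'⟩ := XSpace.exists_le_lNorm hl hε hZ
  obtain ⟨z₂, hz₂, h2, h2'⟩ := XSpace.exists_lNorm_le hl hε hZ
  exact ⟨z₁, hz₁, z₂, hz₂, h1, h2, h1', h2'⟩
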